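/- Let $d\ge 2$ and let $G$ be a finite group of linear automorphisms of $\mathbb C^d$ that is generated by pseudo-reflections (finite-order linear maps $\sigma$ with $\operatorname{rank}(I-\sigma)=1$) and maps the polydisc $\mathbb D^d$ onto itself. Let $\theta=(\theta_1,\dots,\theta_d)$ be a basic polynomial map for $G$, i.e. $\theta_1,\dots,\theta_d$ are algebraically independent polynomials with $\mathbb C[z]^G=\mathbb C[\theta_1,\dots,\theta_d]$. Let $\nu$ be the normalized Haar measure on $\mathbb T^d$. For a one-dimensional representation $\rho$ of $G$ let $\ell_\rho$ be the nonzero homogeneous polynomial, unique up to a scalar, with $\ell_\rho\circ\sigma=\rho(\sigma)\ell_\rho$ for all $\sigma\in G$ such that every polynomial $f$ with $f\circ\sigma=\rho(\sigma)f$ for all $\sigma\in G$ is $\ell_\rho$ times a $G$-invariant polynomial. Let $\mu_{\rho,\theta}$ be the measure with $$\int f\,d\mu_{\rho,\theta}=\frac1{|G|}\int_{\mathbb T^d}(f\circ\theta)\,|\ell_\rho|^2\,d\nu .$$ Let $H^2_\rho(\theta(\mathbb D^d))$ be the space of holomorphic $f:\theta(\mathbb D^d)\to\mathbb C$ with $\ell_\rho\,(f\circ\theta)\in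 H^2(\mathbb D^d)$, regarded as a closed subspace of $L^2(\mu_{\rho,\theta})$ by identifying $f$ with its boundary function $f^*$, where $f^*(\theta(\zeta))=\lim_{r\to1-}f(\theta(r\zeta))$ for almost every $\zeta\in\mathbb T^d$; let $P$ be the orthogonal projection of $L^2(\mu_{\rho,\theta})$ onto it. For $\varphi\in L^2(\mu_{\rho,\theta})$ the big Hankel operator $H_\varphi$ is defined on holomorphic polynomials $q$ in $d$ variables by $H_\varphi q=(I-P)(\varphi q)$. Then the Šilov boundary $\partial\theta(\mathbb D^d)$ of $\theta(\mathbb D^d)$, with respect to the algebra of functions continuous on $\overline{\theta(\mathbb D^d)}$ and holomorphic in $\theta(\mathbb D^d)$, is $\theta(\mathbb T^d)$, and there is a function $\tilde\Phi$ on it with $$\tilde\Phi\circ\theta=\frac1{|G|}\sum_{\sigma\in G}\varphi\circ\sigma\quad \nu\text{-a.e. on }\mathbb T^d,\qquad \varphi(z)=\sum_{n=1}^\infty\frac1n z_1^n\bar z_2^n \ \text{ (convergence in } L^2(\mathbb T^d)),$$ such that for every one-dimensional representation $\rho$ of $G$: (i) $\tilde\Phi\in L^2(\partial\theta(\mathbb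 D^d),\mu_{\rho,\theta})$ and the big Hankel operator $H_{\tilde\Phi}$ is bounded, i.e. there is $C$ with $\|H_{\tilde\Phi}q\|\le C\|q\|$ in $L^2(\mu_{\rho,\theta})$ for all holomorphic polynomials $q$; (ii) there is no $g\in H^2_\rho(\theta(\mathbb D^d))$ with $\tilde\Phi+g^*\in L^\infty(\partial\theta(\mathbb D^d),\mu_{\rho,\theta})$. -/

import Mathlib

open MeasureTheory Filter Topology
open scoped ENNReal ComplexConjugate

/-- The space `ℂ^d`. Linear automorphisms of it form the group `ℂ^d ≃ₗ[ℂ] ℂ^d`. -/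
abbrev CSpace (d : ℕ) : Type := Fin d → ℂ

/-- A pseudo-reflection: a linear map of finite order with `rank (I - σ) = 1`. -/
def IsPseudoReflection {d : ℕ} (σ : CSpace d ≃ₗ[ℂ] CSpace d) : Prop :=
  Module.finrank ℂ (LinearMap.range (LinearMap.id - (σ : CSpace d →ₗ[ℂ] CSpace d))) = 1 ∧
    ∃ n : ℕ, 0 < n ∧ σ ^ n = 1

/-- A pseudo-reflection group: a group generated by pseudo-reflections. -/
def IsPseudoReflectionGroup {d : ℕ} (G : Subgroup (CSpace d ≃ₗ[ℂ] CSpace d)) : Prop :=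
  Subgroup.closure {σ | σ ∈ G ∧ IsPseudoReflection σ} = G

/-- The open unit polydisc `𝔻^d`. -/
def polydisc (d : ℕ) : Set (CSpace d) := {z | ∀ j, ‖z j‖ < 1}

/-- The torus `𝕋^d`, the Šilov boundary of the polydisc. -/
def torus (d : ℕ) : Set (CSpace d) := {z | ∀ j, ‖z j‖ = 1}

/-- `G` acts on the polydisc: it maps the polydisc into (hence onto) itself. -/
def ActsOnPolydisc {d : ℕ} (G : Subgroup (CSpace d ≃ₗ[ℂ] CSpace d)) : Prop :=
  ∀ σ ∈ G, ∀ z ∈ polydisc d, σ z ∈ polydisc d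

/-- `f` is a polynomial relative invariant for the one-dimensional representation `ρ`:
`f ∘ σ = ρ(σ) f` for all `σ ∈ G`. -/
def IsRelInvariant {d : ℕ} {G : Subgroup (CSpace d ≃ₗ[ℂ] CSpace d)} (ρ : G →* ℂˣ)
    (f : MvPolynomial (Fin d) ℂ) : Prop :=
  ∀ (σ : G) (z : CSpace d),
    MvPolynomial.eval ((σ : CSpace d ≃ₗ[ℂ] CSpace d) z) f = (ρ σ : ℂ) * MvPolynomial.eval z f

/-- `f` is a `G`-invariant polynomial. -/
def IsInvariantPoly {d : ℕ} (G : Subgroup (CSpace d ≃ₗ[ℂ] CSpace d))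
    (f : MvPolynomial (Fin d) ℂ) : Prop :=
  ∀ (σ : G) (z : CSpace d),
    MvPolynomial.eval ((σ : CSpace d ≃ₗ[ℂ] CSpace d) z) f = MvPolynomial.eval z f

/-- `θ = (θ₁, …, θ_d)` is a basic polynomial map for `G`: the `θ_j` are algebraically independent
and the ring of `G`-invariant polynomials is `ℂ[θ₁, …, θ_d]`. -/
def IsBasicPolynomialMap {d : ℕ} (G : Subgroup (CSpace d ≃ₗ[ℂ] CSpace d))
    (θ : Fin d → MvPolynomial (Fin d) ℂ) : Prop :=
  AlgebraicIndependent ℂ θ ∧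
    ∀ f : MvPolynomial (Fin d) ℂ, f ∈ Algebra.adjoin ℂ (Set.range θ) ↔ IsInvariantPoly G f

/-- `ℓ` is the polynomial `ℓ_ρ` (unique up to a scalar): a nonzero homogeneous relative invariant such
that every relative invariant for `ρ` is `ℓ` times an invariant polynomial. -/
def IsRelInvariantGenerator {d : ℕ} {G : Subgroup (CSpace d ≃ₗ[ℂ] CSpace d)} (ρ : G →* ℂˣ)
    (ℓ : MvPolynomial (Fin d) ℂ) : Prop :=
  ℓ ≠ 0 ∧ (∃ n : ℕ, ℓ.IsHomogeneous n) ∧ IsRelInvariant ρ ℓ ∧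
    ∀ f : MvPolynomial (Fin d) ℂ, IsRelInvariant ρ f →
      ∃ h : MvPolynomial (Fin d) ℂ, IsInvariantPoly G h ∧ f = ℓ * h

/-- The map `ℂ^d → ℂ^d` given by a tuple of polynomials. -/
noncomputable def polyMap {d : ℕ} (θ : Fin d → MvPolynomial (Fin d) ℂ) (z : CSpace d) : CSpace d :=
  fun j => MvPolynomial.eval z (θ j)

/-- The Šilov boundary of `U` with respect to the algebra `𝒜(U)` of functions continuous on the
closure of `U` and holomorphic in `U`: the intersection of all closed subsets of the closure on
which every member of `𝒜(U)` attains its maximum modulus. -/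
def shilovBoundary {d : ℕ} (U : Set (CSpace d)) : Set (CSpace d) :=
  ⋂₀ {S | IsClosed S ∧ S ⊆ closure U ∧
    ∀ f : CSpace d → ℂ, ContinuousOn f (closure U) → DifferentiableOn ℂ f U →
      ∀ x ∈ closure U, ∃ y ∈ S, ‖f x‖ ≤ ‖f y‖}

/-- The point `(e^{2πi t₁}, …, e^{2πi t_d})` of `𝕋^d`. -/
noncomputable def torusPoint {d : ℕ} (t : UnitAddTorus (Fin d)) : CSpace d :=
  fun j => (AddCircle.toCircle (t j) : ℂ)

/-- The normalized Haar measure `ν` of `𝕋^d`, as a measure on `ℂ^d` carried by `𝕋^d`. -/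
noncomputable def torusMeasure (d : ℕ) : Measure (CSpace d) :=
  Measure.map torusPoint
    (Measure.pi fun _ => AddCircle.haarAddCircle : Measure (UnitAddTorus (Fin d)))

/-- The measure `|ℓ|² dν` on `𝕋^d`. -/
noncomputable def weightedTorusMeasure {d : ℕ} (ℓ : MvPolynomial (Fin d) ℂ) :
    Measure (CSpace d) :=
  (torusMeasure d).withDensity (fun ζ => ‖MvPolynomial.eval ζ ℓ‖ₑ ^ 2)

/-- The measure `μ_{ρ,θ}`, with `ℓ = ℓ_ρ`:
`∫ f dμ_{ρ,θ} = |G|⁻¹ ∫_{𝕋^d} (f ∘ θ) |ℓ|² dν`. It is carried by `θ(𝕋^d)`. -/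
noncomputable def quotientMeasure {d : ℕ} (G : Subgroup (CSpace d ≃ₗ[ℂ] CSpace d))
    (θ : Fin d → MvPolynomial (Fin d) ℂ) (ℓ : MvPolynomial (Fin d) ℂ) : Measure (CSpace d) :=
  ((Nat.card G : ℝ≥0∞)⁻¹) • Measure.map (polyMap θ) (weightedTorusMeasure ℓ)

/-- Membership in the Hardy space `H²(𝔻^d)`. -/
def MemHardyPolydisc {d : ℕ} (f : CSpace d → ℂ) : Prop :=
  DifferentiableOn ℂ f (polydisc d) ∧
    ∃ C : ℝ≥0∞, C < ⊤ ∧ ∀ r : ℝ, 0 ≤ r → r < 1 →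
      ∫⁻ ζ, ‖f ((r : ℂ) • ζ)‖ₑ ^ 2 ∂(torusMeasure d) ≤ C

/-- Membership in the Hardy space `H²_ρ(θ(𝔻^d))`, with `ℓ = ℓ_ρ`. -/
def MemHardyQuotient {d : ℕ} (θ : Fin d → MvPolynomial (Fin d) ℂ) (ℓ : MvPolynomial (Fin d) ℂ)
    (f : CSpace d → ℂ) : Prop :=
  DifferentiableOn ℂ f (polyMap θ '' polydisc d) ∧
    MemHardyPolydisc (fun z => MvPolynomial.eval z ℓ * f (polyMap θ z))

/-- `F` is the boundary function of `f : θ(𝔻^d) → ℂ`: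
`F(θ(ζ)) = lim_{r → 1-} f(θ(rζ))` for almost every `ζ`. -/
def HasBoundaryFunction {d : ℕ} (θ : Fin d → MvPolynomial (Fin d) ℂ)
    (ℓ : MvPolynomial (Fin d) ℂ) (f F : CSpace d → ℂ) : Prop :=
  ∀ᵐ ζ ∂(weightedTorusMeasure ℓ),
    Tendsto (fun r : ℝ => f (polyMap θ ((r : ℂ) • ζ))) (𝓝[<] 1) (𝓝 (F (polyMap θ ζ)))

theorem continuous_polyMap {d : ℕ} (θ : Fin d → MvPolynomial (Fin d) ℂ) :
    Continuous (polyMap θ) :=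
  continuous_pi fun j => MvPolynomial.continuous_eval (θ j)

theorem continuous_torusPoint {d : ℕ} :
    Continuous (torusPoint : UnitAddTorus (Fin d) → CSpace d) :=
  continuous_pi fun j =>
    continuous_subtype_val.comp (AddCircle.continuous_toCircle.comp (continuous_apply j))

theorem ae_comp_polyMap {d : ℕ} {G : Subgroup (CSpace d ≃ₗ[ℂ] CSpace d)} [Finite G]
    {θ : Fin d → MvPolynomial (Fin d) ℂ} {ℓ : MvPolynomial (Fin d) ℂ} {p : CSpace d → Prop}
    (h : ∀ᵐ x ∂(quotientMeasure G θ ℓ), p x) :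
    ∀ᵐ ζ ∂(weightedTorusMeasure ℓ), p (polyMap θ ζ) := by
  have h0 : ((Nat.card G : ℝ≥0∞)⁻¹) ≠ 0 := by simp
  refine ae_of_ae_map (continuous_polyMap θ).aemeasurable ?_
  rw [ae_iff] at h ⊢
  rw [quotientMeasure, Measure.smul_apply, smul_eq_mul, mul_eq_zero] at h
  exact h.resolve_left h0

theorem exists_bound_poly {d : ℕ} (G : Subgroup (CSpace d ≃ₗ[ℂ] CSpace d))
    (θ : Fin d → MvPolynomial (Fin d) ℂ) (ℓ q : MvPolynomial (Fin d) ℂ) :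
    ∃ C : ℝ, ∀ᵐ p ∂(quotientMeasure G θ ℓ), ‖MvPolynomial.eval p q‖ ≤ C := by
  have hc : Continuous fun t : UnitAddTorus (Fin d) =>
      MvPolynomial.eval (polyMap θ (torusPoint t)) q :=
    (MvPolynomial.continuous_eval q).comp ((continuous_polyMap θ).comp continuous_torusPoint)
  obtain ⟨C, hC⟩ := isCompact_univ.exists_bound_of_continuousOn hc.continuousOn
  refine ⟨C, Measure.ae_smul_measure ?_ _⟩
  have hcl : IsClosed {p : CSpace d | ‖MvPolynomial.eval p q‖ ≤ C} :=
    isClosed_le (MvPolynomial.continuous_eval q).norm continuous_const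
  rw [ae_map_iff (continuous_polyMap θ).aemeasurable hcl.measurableSet]
  refine (withDensity_absolutelyContinuous _ _).ae_le ?_
  exact (ae_map_iff continuous_torusPoint.aemeasurable
    (hcl.preimage (continuous_polyMap θ)).measurableSet).2
    (Eventually.of_forall fun t => hC t (Set.mem_univ t))

instance isFiniteMeasure_quotientMeasure {d : ℕ} (G : Subgroup (CSpace d ≃ₗ[ℂ] CSpace d))
    [Finite G] (θ : Fin d → MvPolynomial (Fin d) ℂ) (ℓ : MvPolynomial (Fin d) ℂ) :
    IsFiniteMeasure (quotientMeasure G θ ℓ) := by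
  have hc : Continuous fun t : UnitAddTorus (Fin d) => MvPolynomial.eval (torusPoint t) ℓ :=
    (MvPolynomial.continuous_eval ℓ).comp continuous_torusPoint
  obtain ⟨C, hC⟩ := isCompact_univ.exists_bound_of_continuousOn hc.continuousOn
  have hw : IsFiniteMeasure (weightedTorusMeasure ℓ) := by
    refine isFiniteMeasure_withDensity ?_
    have hm : Measurable fun ζ : CSpace d => ‖MvPolynomial.eval ζ ℓ‖ₑ ^ 2 :=
      (MvPolynomial.continuous_eval ℓ).measurable.enorm.pow_const 2
    rw [torusMeasure, lintegral_map hm continuous_torusPoint.measurable]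
    refine ne_of_lt (lt_of_le_of_lt (lintegral_mono
      (g := fun _ => ENNReal.ofReal C ^ 2) fun t => ?_) ?_)
    · refine pow_le_pow_left' ?_ 2
      rw [← ofReal_norm]
      exact ENNReal.ofReal_le_ofReal (hC t (Set.mem_univ t))
    · rw [lintegral_const]
      exact ENNReal.mul_lt_top (ENNReal.pow_lt_top ENNReal.ofReal_lt_top) (measure_lt_top _ _)
  have hG : (Nat.card G : ℝ≥0∞)⁻¹ ≠ ⊤ := by
    simp [Nat.card_pos.ne']
  exact Measure.smul_finite _ hG

theorem memLp_symbol_mul_poly {d : ℕ} (G : Subgroup (CSpace d ≃ₗ[ℂ] CSpace d))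
    (θ : Fin d → MvPolynomial (Fin d) ℂ) (ℓ : MvPolynomial (Fin d) ℂ) {φ : CSpace d → ℂ}
    (hφ : MemLp φ 2 (quotientMeasure G θ ℓ)) (q : MvPolynomial (Fin d) ℂ) :
    MemLp (fun p => φ p * MvPolynomial.eval p q) 2 (quotientMeasure G θ ℓ) := by
  obtain ⟨C, hC⟩ := exists_bound_poly G θ ℓ q
  have := MemLp.of_le_mul (c := C) hφ
    (hφ.1.mul (MvPolynomial.continuous_eval q).aestronglyMeasurable)
    (hC.mono fun p hp => by
      simp only [Pi.mul_apply, norm_mul]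
      rw [mul_comm]
      exact mul_le_mul_of_nonneg_right hp (norm_nonneg _))
  exact this

theorem memHardyPolydisc_zero {d : ℕ} : MemHardyPolydisc (fun _ : CSpace d => (0 : ℂ)) :=
  ⟨differentiableOn_const _, 0, by simp, by simp⟩

theorem MemHardyPolydisc.add {d : ℕ} {f g : CSpace d → ℂ} (hf : MemHardyPolydisc f)
    (hg : MemHardyPolydisc g) : MemHardyPolydisc (fun z => f z + g z) := by
  obtain ⟨hf, C, hC, hfC⟩ := hf
  obtain ⟨hg, D, hD, hgD⟩ := hg
  refine ⟨hf.add hg, 2 * C + 2 * D, by finiteness, fun r hr0 hr1 => ?_⟩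
  have hbd : ∀ ζ ∈ torus d, (r : ℂ) • ζ ∈ polydisc d := by
    intro ζ hζ j
    simp [hζ j, abs_of_nonneg hr0, hr1]
  have hct : ContinuousOn (fun ζ : CSpace d => ‖f ((r : ℂ) • ζ)‖ₑ ^ 2) (torus d) := by
    have h1 : ContinuousOn (fun ζ : CSpace d => f ((r : ℂ) • ζ)) (torus d) :=
      hf.continuousOn.comp (by fun_prop) hbd
    exact (ENNReal.continuous_pow 2).comp_continuousOn h1.enorm
  have htc : IsClosed (torus d) := by
    simp only [torus, Set.ofPred_forall]
    exact isClosed_iInter fun j => isClosed_eq (by fun_prop) continuous_const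
  have hae : ∀ᵐ ζ ∂(torusMeasure d), ζ ∈ torus d := by
    exact (ae_map_iff continuous_torusPoint.aemeasurable htc.measurableSet).2
      (Eventually.of_forall fun t j => Circle.norm_coe _)
  have hm : AEMeasurable (fun ζ : CSpace d => ‖f ((r : ℂ) • ζ)‖ₑ ^ 2) (torusMeasure d) := by
    rw [← Measure.restrict_eq_self_of_ae_mem hae]
    exact hct.aemeasurable htc.measurableSet
  calc ∫⁻ ζ, ‖f ((r : ℂ) • ζ) + g ((r : ℂ) • ζ)‖ₑ ^ 2 ∂(torusMeasure d)
      ≤ ∫⁻ ζ, (2 * ‖f ((r : ℂ) • ζ)‖ₑ ^ 2 + 2 * ‖g ((r : ℂ) • ζ)‖ₑ ^ 2) ∂(torusMeasure d) := by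
        refine lintegral_mono fun ζ => ?_
        refine (pow_le_pow_left' (enorm_add_le _ _) 2).trans ?_
        have := ENNReal.rpow_add_le_mul_rpow_add_rpow ‖f ((r : ℂ) • ζ)‖ₑ ‖g ((r : ℂ) • ζ)‖ₑ
          (p := 2) (by norm_num)
        norm_num at this
        rw [mul_add] at this
        exact this
    _ = 2 * ∫⁻ ζ, ‖f ((r : ℂ) • ζ)‖ₑ ^ 2 ∂(torusMeasure d)
          + 2 * ∫⁻ ζ, ‖g ((r : ℂ) • ζ)‖ₑ ^ 2 ∂(torusMeasure d) := by
        rw [lintegral_add_left' (hm.const_mul 2), lintegral_const_mul' _ _ (by simp),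
          lintegral_const_mul' _ _ (by simp)]
    _ ≤ 2 * C + 2 * D := by
        gcongr
        · exact hfC r hr0 hr1
        · exact hgD r hr0 hr1

theorem MemHardyPolydisc.const_mul {d : ℕ} {f : CSpace d → ℂ} (c : ℂ)
    (hf : MemHardyPolydisc f) : MemHardyPolydisc (fun z => c * f z) := by
  obtain ⟨hf, C, hC, hfC⟩ := hf
  refine ⟨hf.const_mul c, ‖c‖ₑ ^ 2 * C,
    ENNReal.mul_lt_top (ENNReal.pow_lt_top enorm_lt_top) hC, fun r hr0 hr1 => ?_⟩
  simp only [enorm_mul, mul_pow]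
  rw [lintegral_const_mul' _ _ (by finiteness)]
  gcongr
  exact hfC r hr0 hr1

/-- The Hardy space `H²_ρ(θ(𝔻^d))` as a subspace of `L²(∂θ(𝔻^d), μ_{ρ,θ})`, through boundary
functions. -/
noncomputable def hardySubspace {d : ℕ} (G : Subgroup (CSpace d ≃ₗ[ℂ] CSpace d)) [Finite G]
    (θ : Fin d → MvPolynomial (Fin d) ℂ) (ℓ : MvPolynomial (Fin d) ℂ) :
    Submodule ℂ (Lp ℂ 2 (quotientMeasure G θ ℓ)) where
  carrier := {F | ∃ f : CSpace d → ℂ, MemHardyQuotient θ ℓ f ∧ HasBoundaryFunction θ ℓ f F}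
  zero_mem' := by
    refine ⟨fun _ => 0, ⟨differentiableOn_const _, by
      simpa using memHardyPolydisc_zero⟩, ?_⟩
    filter_upwards [ae_comp_polyMap (Lp.coeFn_zero ℂ 2 (quotientMeasure G θ ℓ))] with ζ h
    rw [h]
    exact tendsto_const_nhds
  add_mem' := by
    rintro F F' ⟨f, hf, hfF⟩ ⟨g, hg, hgF⟩
    refine ⟨fun z => f z + g z, ⟨hf.1.add hg.1, by
      simpa [mul_add] using hf.2.add hg.2⟩, ?_⟩
    filter_upwards [ae_comp_polyMap (Lp.coeFn_add F F'), hfF, hgF] with ζ h h1 h2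
    rw [h]
    exact h1.add h2
  smul_mem' := by
    rintro c F ⟨f, hf, hfF⟩
    refine ⟨fun z => c * f z, ⟨hf.1.const_mul c, by
      simpa [mul_left_comm] using hf.2.const_mul c⟩, ?_⟩
    filter_upwards [ae_comp_polyMap (Lp.coeFn_smul c F), hfF] with ζ h h1
    rw [h]
    exact h1.const_mul c

/-- The class in `L²(∂θ(𝔻^d), μ_{ρ,θ})` of the product of a symbol `φ ∈ L²` and a holomorphic
polynomial `q`. -/
noncomputable def symbolMul {d : ℕ} (G : Subgroup (CSpace d ≃ₗ[ℂ] CSpace d))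
    (θ : Fin d → MvPolynomial (Fin d) ℂ) (ℓ : MvPolynomial (Fin d) ℂ) {φ : CSpace d → ℂ}
    (hφ : MemLp φ 2 (quotientMeasure G θ ℓ)) (q : MvPolynomial (Fin d) ℂ) :
    Lp ℂ 2 (quotientMeasure G θ ℓ) :=
  (memLp_symbol_mul_poly G θ ℓ hφ q).toLp _

/-- The class of a holomorphic polynomial in `L²(∂θ(𝔻^d), μ_{ρ,θ})`. -/
noncomputable def polyClass {d : ℕ} (G : Subgroup (CSpace d ≃ₗ[ℂ] CSpace d)) [Finite G]
    (θ : Fin d → MvPolynomial (Fin d) ℂ) (ℓ : MvPolynomial (Fin d) ℂ)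
    (q : MvPolynomial (Fin d) ℂ) : Lp ℂ 2 (quotientMeasure G θ ℓ) :=
  symbolMul G θ ℓ (φ := fun _ => 1) (memLp_const 1) q

/-- The big Hankel operator `H_φ q = (I - P)(φ q)` on holomorphic polynomials `q`, where `P` is
the orthogonal projection onto the Hardy space, so that `I - P` is the orthogonal projection onto
its orthogonal complement. -/
noncomputable def bigHankel {d : ℕ} (G : Subgroup (CSpace d ≃ₗ[ℂ] CSpace d)) [Finite G]
    (θ : Fin d → MvPolynomial (Fin d) ℂ) (ℓ : MvPolynomial (Fin d) ℂ) {φ : CSpace d → ℂ}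
    (hφ : MemLp φ 2 (quotientMeasure G θ ℓ)) (q : MvPolynomial (Fin d) ℂ) :
    ((hardySubspace G θ ℓ)ᗮ : Submodule ℂ (Lp ℂ 2 (quotientMeasure G θ ℓ))) :=
  (hardySubspace G θ ℓ)ᗮ.orthogonalProjectionOnto (symbolMul G θ ℓ hφ q)

/-- The densely defined operator `H_φ` is bounded on `H²_ρ(θ(𝔻^d))`. -/
def IsBoundedBigHankel {d : ℕ} (G : Subgroup (CSpace d ≃ₗ[ℂ] CSpace d)) [Finite G]
    (θ : Fin d → MvPolynomial (Fin d) ℂ) (ℓ : MvPolynomial (Fin d) ℂ) {φ : CSpace d → ℂ}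
    (hφ : MemLp φ 2 (quotientMeasure G θ ℓ)) : Prop :=
  ∃ C : ℝ, ∀ q : MvPolynomial (Fin d) ℂ, ‖bigHankel G θ ℓ hφ q‖ ≤ C * ‖polyClass G θ ℓ q‖

/-- The partial sum `∑_{n=1}^N z_iⁿ conj(z_j)ⁿ / n`. -/
noncomputable def partialSymbol {d : ℕ} (i j : Fin d) (N : ℕ) (z : CSpace d) : ℂ :=
  ∑ n ∈ Finset.Icc 1 N, (1 / (n : ℂ)) * z i ^ n * (conj (z j)) ^ n

/-- `Φ ∘ θ` is the average over `G` of the function `∑_{n≥1} z_iⁿ conj(z_j)ⁿ / n`, the series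
being summed in `L²(𝕋^d)`. -/
def IsAveragedSymbol {d : ℕ} (G : Subgroup (CSpace d ≃ₗ[ℂ] CSpace d)) [Fintype G]
    (θ : Fin d → MvPolynomial (Fin d) ℂ) (i j : Fin d) (Φ : CSpace d → ℂ) : Prop :=
  Tendsto (fun N : ℕ => eLpNorm (fun ζ : CSpace d => Φ (polyMap θ ζ) -
      (Fintype.card G : ℂ)⁻¹ *
        ∑ σ : G, partialSymbol i j N ((σ : CSpace d ≃ₗ[ℂ] CSpace d) ζ)) 2 (torusMeasure d))
    atTop (𝓝 0)

/-! The series sums to φ = -log(1 - z_i conj z_j), whose real part is unbounded above while its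
imaginary part, an argument, is bounded. Both halves of the theorem come from this contrast.

Boundedness. For a polynomial Q let R be the part of φQ with nonnegative frequency in z_j. Only
finitely many terms of the series contribute to it, so R is a polynomial. Then φQ - R has negative
frequencies in z_j, whereas R - conj(φ)Q has nonnegative ones, because conj(φ) only raises them. The
two are orthogonal and add up to (φ - conj φ)Q, whence ‖φQ - R‖ ≤ 2π‖Q‖
(`exists_polynomial_eLpNorm_sub_le`). For Q = ℓ·(q ∘ θ), averaging against ρ⁻¹ turns φQ - R into
ℓ·((Φq - q') ∘ θ) for a polynomial q' without increasing the norm, since G preserves Haar measure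
(`exists_polynomial_approximant`). So Φq lies within 2π‖q‖ of the Hardy space.

No bounded correction. Let E be the set where z_i conj z_j is close to, but not equal to, 1. It is
invariant under ζ ↦ cζ with |c| = 1, and so is |ℓ|, ℓ being homogeneous; hence the mean of g* ∘ θ
over E for |ℓ|²dν is g(θ(0)), however small E is (`setIntegral_nearDiagonal`). On E the averaged
symbol has large real part (`le_re_averagedLog`), so if Φ + g* were bounded, Re g(θ(0)) would lie
below every real number.

Šilov boundary. Sums over G of high powers of a polynomial peaking at ζ are invariant polynomials,
hence polynomials in θ, and they separate the orbit of ζ in modulus from compact sets off it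
(`exists_invariant_peak`). The opposite inclusion is the maximum principle of the polydisc. -/

/-! ### The polydisc, the torus and the action of G on them. -/

theorem polydisc_eq_ball (d : ℕ) : polydisc d = Metric.ball 0 1 := by
  ext z
  simp [polydisc, pi_norm_lt_iff]

theorem torus_subset_closedBall (d : ℕ) : torus d ⊆ Metric.closedBall 0 1 := by
  intro z hz
  rw [mem_closedBall_zero_iff, pi_norm_le_iff_of_nonneg zero_le_one]
  exact fun j => (hz j).le

theorem isClosed_torus (d : ℕ) : IsClosed (torus d) := by
  simp only [torus, Set.ofPred_forall]
  exact isClosed_iInter fun j => isClosed_eq (by fun_prop) continuous_const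

theorem isCompact_torus (d : ℕ) : IsCompact (torus d) :=
  (isCompact_closedBall 0 1).of_isClosed_subset (isClosed_torus d) (torus_subset_closedBall d)

theorem torusPoint_mem_torus {d : ℕ} (t : UnitAddTorus (Fin d)) : torusPoint t ∈ torus d :=
  fun _ => Circle.norm_coe _

theorem exists_toCircle_eq (c : Circle) : ∃ s : UnitAddCircle, AddCircle.toCircle s = c := by
  obtain ⟨s, hs⟩ := (AddCircle.homeomorphCircle (T := 1) one_ne_zero).surjective c
  exact ⟨s, by rw [← hs, AddCircle.homeomorphCircle_apply]⟩

theorem exists_torusPoint_eq {d : ℕ} {z : CSpace d} (hz : z ∈ torus d) :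
    ∃ t : UnitAddTorus (Fin d), torusPoint t = z := by
  choose t ht using fun j => exists_toCircle_eq ⟨z j, mem_sphere_zero_iff_norm.2 (hz j)⟩
  exact ⟨t, funext fun j => by rw [torusPoint, ht]⟩

instance isProbabilityMeasure_torusMeasure (d : ℕ) : IsProbabilityMeasure (torusMeasure d) :=
  Measure.isProbabilityMeasure_map continuous_torusPoint.aemeasurable

theorem ae_mem_torus (d : ℕ) : ∀ᵐ ζ ∂(torusMeasure d), ζ ∈ torus d :=
  (ae_map_iff continuous_torusPoint.aemeasurable (isClosed_torus d).measurableSet).2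
    (Eventually.of_forall torusPoint_mem_torus)

/-- The polydisc is the unit ball of the supremum norm, so preserving it makes a linear map a
contraction by scaling. Applied to inverses as well, this makes G a group of isometries. -/
theorem ActsOnPolydisc.norm_map_le {d : ℕ} {G : Subgroup (CSpace d ≃ₗ[ℂ] CSpace d)}
    (hG : ActsOnPolydisc G) {σ : CSpace d ≃ₗ[ℂ] CSpace d} (hσ : σ ∈ G) (z : CSpace d) :
    ‖σ z‖ ≤ ‖z‖ := by
  refine le_of_forall_gt_imp_ge_of_dense fun c hc => ?_
  have hc0 : 0 < c := (norm_nonneg z).trans_lt hc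
  have hz : ((c : ℂ)⁻¹) • z ∈ polydisc d := by
    rw [polydisc_eq_ball, mem_ball_zero_iff, norm_smul, norm_inv, Complex.norm_real,
      Real.norm_of_nonneg hc0.le]
    rwa [inv_mul_lt_one₀ hc0]
  have := hG σ hσ _ hz
  rw [polydisc_eq_ball, mem_ball_zero_iff, map_smul, norm_smul, norm_inv, Complex.norm_real,
      Real.norm_of_nonneg hc0.le, inv_mul_lt_one₀ hc0] at this
  exact this.le

theorem ActsOnPolydisc.norm_map {d : ℕ} {G : Subgroup (CSpace d ≃ₗ[ℂ] CSpace d)}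
    (hG : ActsOnPolydisc G) {σ : CSpace d ≃ₗ[ℂ] CSpace d} (hσ : σ ∈ G) (z : CSpace d) :
    ‖σ z‖ = ‖z‖ := by
  refine le_antisymm (hG.norm_map_le hσ z) ?_
  have := hG.norm_map_le (G.inv_mem hσ) (σ z)
  rwa [← LinearEquiv.mul_apply, inv_mul_cancel] at this

/-- A linear isometry of `ℂ^d` for the supremum norm permutes the coordinates up to unimodular
factors. -/
theorem exists_perm_of_norm_map {d : ℕ} (σ : CSpace d ≃ₗ[ℂ] CSpace d)
    (hσ : ∀ z, ‖σ z‖ = ‖z‖) :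
    ∃ (π : Equiv.Perm (Fin d)) (c : Fin d → Circle), ∀ z j, σ z j = c j * z (π j) := by
  -- Choose a row j where the column of e_i has an entry a of modulus 1. For any other entry b of
  -- that row, e_i ± e_k has norm at most 1, so |a ± b| ≤ 1, and the parallelogram law gives 2 +
  -- 2|b|² ≤ 2.
  have hrow : ∀ i, ∃ j, ‖σ (Pi.single i 1) j‖ = 1 ∧ ∀ k, k ≠ i → σ (Pi.single k 1) j = 0 := by
    intro i
    have hne : Nonempty (Fin d) := ⟨i⟩
    have h1 : ‖σ (Pi.single i 1)‖ = 1 := by rw [hσ, Pi.norm_single, norm_one]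
    obtain ⟨j, hj⟩ := (Finite.exists_max fun j => ‖σ (Pi.single i 1) j‖)
    have hj1 : ‖σ (Pi.single i 1) j‖ = 1 := by
      refine le_antisymm (h1 ▸ norm_le_pi_norm _ j) ?_
      rw [← h1]
      exact (pi_norm_le_iff_of_nonneg (norm_nonneg _)).2 hj
    refine ⟨j, hj1, fun k hk => ?_⟩
    have hb : ∀ u : ℂ, ‖u‖ = 1 → ‖σ (Pi.single i 1) j + u * σ (Pi.single k 1) j‖ ≤ 1 := by
      intro u hu
      have h2 : ‖(Pi.single i 1 + u • Pi.single k 1 : CSpace d)‖ ≤ 1 := by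
        refine (pi_norm_le_iff_of_nonneg zero_le_one).2 fun l => ?_
        by_cases hl : l = i
        · subst hl
          simp [hk.symm]
        · by_cases hl' : l = k
          · subst hl'
            simp [hl, hu]
          · simp [hl, hl']
      have h3 := (norm_le_pi_norm (σ (Pi.single i 1 + u • Pi.single k 1)) j).trans
        ((hσ _).le.trans h2)
      simpa using h3
    have hp := hb 1 (by simp)
    have hm := hb (-1) (by simp)
    have hpar := parallelogram_law_with_norm ℂ (σ (Pi.single i 1) j) (σ (Pi.single k 1) j)
    rw [hj1] at hpar
    simp only [one_mul, neg_mul, ← sub_eq_add_neg] at hp hm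
    have : ‖σ (Pi.single k 1) j‖ = 0 := by
      nlinarith [norm_nonneg (σ (Pi.single i 1) j + σ (Pi.single k 1) j),
        norm_nonneg (σ (Pi.single i 1) j - σ (Pi.single k 1) j), norm_nonneg (σ (Pi.single k 1) j)]
    exact norm_eq_zero.1 this
  choose r hr1 hr0 using hrow
  have hinj : Function.Injective r := by
    intro i i' h
    by_contra hne
    have := hr0 i i' (Ne.symm hne)
    rw [h] at this
    simpa [this] using hr1 i'
  let e : Equiv.Perm (Fin d) := Equiv.ofBijective r (Finite.injective_iff_bijective.1 hinj)
  have he : ∀ j, r (e.symm j) = j := fun j => e.apply_symm_apply j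
  refine ⟨e.symm, fun j => ⟨σ (Pi.single (e.symm j) 1) j, ?_⟩, fun z j => ?_⟩
  · have := hr1 (e.symm j)
    rw [he] at this
    simp [Submonoid.unitSphere, this]
  · have hz : z = ∑ k, z k • (Pi.single k 1 : CSpace d) := by
      ext l
      simp [Finset.sum_apply, Pi.single_apply]
    conv_lhs => rw [hz, map_sum]
    rw [Finset.sum_apply, Finset.sum_eq_single (e.symm j)]
    · simp [mul_comm]
    · intro k _ hk
      have := hr0 (e.symm j) k hk
      rw [he] at this
      simp [this]
    · simp

/-- In angular coordinates a monomial map with unimodular entries is a permutation of the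
coordinates followed by a translation; both preserve Haar measure. -/
theorem measurePreserving_of_norm_map {d : ℕ} (σ : CSpace d ≃ₗ[ℂ] CSpace d)
    (hσ : ∀ z, ‖σ z‖ = ‖z‖) : MeasurePreserving σ (torusMeasure d) (torusMeasure d) := by
  obtain ⟨π, c, h⟩ := exists_perm_of_norm_map σ hσ
  have hc : ∀ j, ∃ s : UnitAddCircle, AddCircle.toCircle s = c j :=
    fun j => exists_toCircle_eq (c j)
  choose s hs using hc
  have h1 : MeasurePreserving (fun t : UnitAddTorus (Fin d) => fun j => t (π j))
      (Measure.pi fun _ => AddCircle.haarAddCircle) (Measure.pi fun _ => AddCircle.haarAddCircle) := by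
    have := (measurePreserving_piCongrLeft
      (fun _ : Fin d => (AddCircle.haarAddCircle : Measure UnitAddCircle)) π).symm
    exact this
  have h2 : MeasurePreserving (fun t : UnitAddTorus (Fin d) => s + t)
      (Measure.pi fun _ => AddCircle.haarAddCircle) (Measure.pi fun _ => AddCircle.haarAddCircle) :=
    measurePreserving_add_left _ s
  have hcont : Continuous σ := LinearMap.continuous_of_finiteDimensional σ.toLinearMap
  refine ⟨hcont.measurable, ?_⟩
  rw [torusMeasure, Measure.map_map hcont.measurable continuous_torusPoint.measurable]
  conv_rhs => rw [← (h2.comp h1).map_eq]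
  rw [Measure.map_map continuous_torusPoint.measurable (h2.comp h1).measurable]
  congr 1
  ext t j
  simp [h, torusPoint, hs, AddCircle.toCircle_add]

/-! ### Invariant and relatively invariant polynomials. -/

theorem exists_eval_comp_linear {d : ℕ} (σ : CSpace d ≃ₗ[ℂ] CSpace d)
    (p : MvPolynomial (Fin d) ℂ) :
    ∃ q : MvPolynomial (Fin d) ℂ, ∀ z, MvPolynomial.eval z q = MvPolynomial.eval (σ z) p := by
  refine ⟨MvPolynomial.aeval (fun j => ∑ k, MvPolynomial.C (σ (Pi.single k 1) j) *
    MvPolynomial.X k) p, fun z => ?_⟩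
  have hz : ∀ j, σ z j = ∑ k, σ (Pi.single k 1) j * z k := by
    intro j
    have hz : z = ∑ k, z k • (Pi.single k 1 : CSpace d) := by
      ext l
      simp [Finset.sum_apply, Pi.single_apply]
    conv_lhs => rw [hz, map_sum]
    rw [Finset.sum_apply]
    simp [mul_comm]
  induction p using MvPolynomial.induction_on with
  | C a => simp
  | add p q hp hq => simp only [map_add, hp, hq]
  | mul_X p j hp => simp only [map_mul, hp, MvPolynomial.aeval_X, MvPolynomial.eval_X, map_sum,
      MvPolynomial.eval_C, hz]

theorem eval_aeval_polyMap {d : ℕ} (θ : Fin d → MvPolynomial (Fin d) ℂ)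
    (q : MvPolynomial (Fin d) ℂ) (z : CSpace d) :
    MvPolynomial.eval z (MvPolynomial.aeval θ q) = MvPolynomial.eval (polyMap θ z) q := by
  induction q using MvPolynomial.induction_on with
  | C a => simp
  | add p q hp hq => simp only [map_add, hp, hq]
  | mul_X p j hp => simp only [map_mul, hp, MvPolynomial.aeval_X, MvPolynomial.eval_X, polyMap]

theorem IsBasicPolynomialMap.exists_eval_eq {d : ℕ} {G : Subgroup (CSpace d ≃ₗ[ℂ] CSpace d)}
    {θ : Fin d → MvPolynomial (Fin d) ℂ} (hθ : IsBasicPolynomialMap G θ)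
    {h : MvPolynomial (Fin d) ℂ} (hh : IsInvariantPoly G h) :
    ∃ q : MvPolynomial (Fin d) ℂ,
      ∀ z, MvPolynomial.eval z h = MvPolynomial.eval (polyMap θ z) q := by
  have := (hθ.2 h).2 hh
  rw [Algebra.adjoin_range_eq_range_aeval] at this
  obtain ⟨q, rfl⟩ := this
  exact ⟨q, eval_aeval_polyMap θ q⟩

theorem IsBasicPolynomialMap.polyMap_map {d : ℕ} {G : Subgroup (CSpace d ≃ₗ[ℂ] CSpace d)}
    {θ : Fin d → MvPolynomial (Fin d) ℂ} (hθ : IsBasicPolynomialMap G θ) (σ : G) (z : CSpace d) :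
    polyMap θ ((σ : CSpace d ≃ₗ[ℂ] CSpace d) z) = polyMap θ z :=
  funext fun j => (hθ.2 (θ j)).1 (Algebra.subset_adjoin ⟨j, rfl⟩) σ z

/-- Twisted averaging over `G` turns every polynomial into a relative invariant. -/
theorem exists_relInvariant_average {d : ℕ} {G : Subgroup (CSpace d ≃ₗ[ℂ] CSpace d)} [Fintype G]
    (ρ : G →* ℂˣ) (f : MvPolynomial (Fin d) ℂ) :
    ∃ p : MvPolynomial (Fin d) ℂ, IsRelInvariant ρ p ∧ ∀ z, MvPolynomial.eval z p =
      ∑ σ : G, ((ρ σ)⁻¹ : ℂˣ) * MvPolynomial.eval ((σ : CSpace d ≃ₗ[ℂ] CSpace d) z) f := by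
  choose q hq using fun σ : G => exists_eval_comp_linear (σ : CSpace d ≃ₗ[ℂ] CSpace d) f
  have hp : ∀ z, MvPolynomial.eval z
      (∑ σ : G, MvPolynomial.C (((ρ σ)⁻¹ : ℂˣ) : ℂ) * q σ) =
      ∑ σ : G, ((ρ σ)⁻¹ : ℂˣ) * MvPolynomial.eval ((σ : CSpace d ≃ₗ[ℂ] CSpace d) z) f := by
    intro z
    simp [hq]
  refine ⟨_, fun τ z => ?_, hp⟩
  rw [hp, hp, Finset.mul_sum]
  -- Reindexing by σ ↦ στ releases the factor ρ(τ).
  refine Fintype.sum_equiv (Equiv.mulRight τ) _ _ fun σ => ?_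
  simp only [Equiv.coe_mulRight, Subgroup.coe_mul, map_mul, mul_inv_rev, Units.val_mul,
    LinearEquiv.mul_apply, ← mul_assoc, Units.mul_inv, one_mul]

theorem exists_invariant_sum {d : ℕ} (G : Subgroup (CSpace d ≃ₗ[ℂ] CSpace d)) [Fintype G]
    (f : MvPolynomial (Fin d) ℂ) :
    ∃ p : MvPolynomial (Fin d) ℂ, IsInvariantPoly G p ∧ ∀ z, MvPolynomial.eval z p =
      ∑ σ : G, MvPolynomial.eval ((σ : CSpace d ≃ₗ[ℂ] CSpace d) z) f := by
  obtain ⟨p, hp, h⟩ := exists_relInvariant_average (1 : G →* ℂˣ) f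
  exact ⟨p, fun σ z => by simpa using hp σ z, fun z => by simpa using h z⟩

/-! ### Peak polynomials, the maximum principle and the Šilov boundary. -/

theorem norm_one_add_lt_two {u : ℂ} (hu : ‖u‖ ≤ 1) (h : u ≠ 1) : ‖1 + u‖ < 2 := by
  have h1 : ‖1 + u‖ ≤ 2 := (norm_add_le _ _).trans (by rw [norm_one]; linarith)
  refine lt_of_le_of_ne h1 fun h2 => h ?_
  have h3 : ‖1 + u‖ ^ 2 = 4 := by rw [h2]; norm_num
  have h4 : ‖u‖ ^ 2 ≤ 1 := pow_le_one₀ (norm_nonneg _) hu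
  rw [← Complex.normSq_eq_norm_sq, Complex.normSq_apply] at h3 h4
  simp only [Complex.add_re, Complex.one_re, Complex.add_im, Complex.one_im, zero_add] at h3
  have hre : u.re = 1 := by nlinarith [mul_self_nonneg u.im, mul_self_nonneg (u.re - 1)]
  have him : u.im = 0 := by
    have : u.im * u.im = 0 := by rw [hre] at h4; nlinarith [mul_self_nonneg u.im]
    simpa using this
  exact Complex.ext hre him

/-- The product of the factors (1 + conj(ζ_j) z_j)/2 works: each has modulus at most 1 on the closed
polydisc, and by strict convexity of the disc modulus 1 is reached only at z_j = ζ_j. -/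
theorem exists_peak_polynomial {d : ℕ} {ζ : CSpace d} (hζ : ζ ∈ torus d) :
    ∃ h : MvPolynomial (Fin d) ℂ, MvPolynomial.eval ζ h = 1 ∧
      ∀ z ∈ Metric.closedBall (0 : CSpace d) 1, z ≠ ζ → ‖MvPolynomial.eval z h‖ < 1 := by
  have hζ1 : ∀ j, conj (ζ j) * ζ j = 1 := by
    intro j
    rw [mul_comm, Complex.mul_conj, Complex.normSq_eq_norm_sq, hζ j]
    simp
  refine ⟨∏ j, MvPolynomial.C (1 / 2) * (1 + MvPolynomial.C (conj (ζ j)) * MvPolynomial.X j),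
    ?_, fun z hz hne => ?_⟩
  · simp only [map_prod, map_mul, map_add, MvPolynomial.eval_C, MvPolynomial.eval_X, map_one, hζ1]
    norm_num
  · rw [mem_closedBall_zero_iff, pi_norm_le_iff_of_nonneg zero_le_one] at hz
    simp only [map_prod, map_mul, map_add, MvPolynomial.eval_C, MvPolynomial.eval_X, map_one,
      norm_prod, norm_mul]
    have hle : ∀ j, ‖(1 / 2 : ℂ)‖ * ‖1 + conj (ζ j) * z j‖ ≤ 1 := by
      intro j
      have : ‖1 + conj (ζ j) * z j‖ ≤ 2 := (norm_add_le _ _).trans (by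
        rw [norm_one, norm_mul, RCLike.norm_conj, hζ j]; linarith [hz j])
      norm_num
      linarith
    obtain ⟨i, hi⟩ := Function.ne_iff.1 hne
    rw [← Finset.mul_prod_erase _ _ (Finset.mem_univ i)]
    refine (mul_le_of_le_one_right (by positivity)
      (Finset.prod_le_one (fun j _ => by positivity) fun j _ => hle j)).trans_lt ?_
    have : ‖1 + conj (ζ i) * z i‖ < 2 := by
      refine norm_one_add_lt_two (by
        rw [norm_mul, RCLike.norm_conj, hζ i, one_mul]; exact hz i) fun h => hi ?_
      calc z i = (conj (ζ i) * ζ i) * z i := by rw [hζ1, one_mul]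
        _ = ζ i * (conj (ζ i) * z i) := by ring
        _ = ζ i := by rw [h, mul_one]
    norm_num
    linarith

/-- Invariant polynomials separate a torus orbit from compact sets off it, in modulus. -/
theorem exists_invariant_peak {d : ℕ} {G : Subgroup (CSpace d ≃ₗ[ℂ] CSpace d)} [Fintype G]
    (hG : ActsOnPolydisc G) {ζ : CSpace d} (hζ : ζ ∈ torus d) {K : Set (CSpace d)}
    (hK : IsCompact K) (hK1 : K ⊆ Metric.closedBall 0 1)
    (hKζ : ∀ σ : G, (σ : CSpace d ≃ₗ[ℂ] CSpace d) ζ ∉ K) :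
    ∃ p : MvPolynomial (Fin d) ℂ, IsInvariantPoly G p ∧
      ∀ z ∈ K, ‖MvPolynomial.eval z p‖ < ‖MvPolynomial.eval ζ p‖ := by
  classical
  obtain ⟨h, hh1, hh⟩ := exists_peak_polynomial hζ
  have hball : ∀ (σ : G) (z : CSpace d), z ∈ Metric.closedBall (0 : CSpace d) 1 →
      (σ : CSpace d ≃ₗ[ℂ] CSpace d) z ∈ Metric.closedBall (0 : CSpace d) 1 := by
    intro σ z hz
    rw [mem_closedBall_zero_iff] at hz ⊢
    rwa [hG.norm_map σ.2]
  have hc : ∀ σ : G, ∃ c : ℝ, 0 ≤ c ∧ c < 1 ∧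
      ∀ z ∈ K, ‖MvPolynomial.eval ((σ : CSpace d ≃ₗ[ℂ] CSpace d) z) h‖ ≤ c := by
    intro σ
    rcases K.eq_empty_or_nonempty with rfl | hne
    · exact ⟨0, le_rfl, one_pos, by simp⟩
    have hcont : Continuous fun z : CSpace d =>
        ‖MvPolynomial.eval ((σ : CSpace d ≃ₗ[ℂ] CSpace d) z) h‖ :=
      ((MvPolynomial.continuous_eval h).comp
        (LinearMap.continuous_of_finiteDimensional
          (σ : CSpace d ≃ₗ[ℂ] CSpace d).toLinearMap)).norm
    obtain ⟨z, hz, hmax⟩ := hK.exists_isMaxOn hne hcont.continuousOn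
    refine ⟨_, norm_nonneg _, hh _ (hball σ z (hK1 hz)) fun he => ?_, fun w hw => hmax hw⟩
    refine hKζ σ⁻¹ ?_
    rw [← he, ← LinearEquiv.mul_apply, ← Subgroup.coe_mul, inv_mul_cancel]
    exact hz
  choose c hc0 hc1 hcK using hc
  -- On K every term of the sum decays geometrically. At ζ each term tends to 1 or 0 according to
  -- whether σ fixes ζ, so there is no cancellation and the limit is the order of the stabilizer, at
  -- least 1.
  choose p hp hpe using fun N : ℕ => exists_invariant_sum G (h ^ N)
  have hlim0 : Tendsto (fun N : ℕ => ∑ σ : G, c σ ^ N) atTop (𝓝 0) := by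
    have := tendsto_finsetSum (Finset.univ : Finset G) fun σ _ =>
      tendsto_pow_atTop_nhds_zero_of_lt_one (hc0 σ) (hc1 σ)
    simpa using this
  have hlim1 : Tendsto (fun N : ℕ => MvPolynomial.eval ζ (p N)) atTop
      (𝓝 (∑ σ : G, if (σ : CSpace d ≃ₗ[ℂ] CSpace d) ζ = ζ then 1 else 0)) := by
    simp only [hpe, map_pow]
    refine tendsto_finsetSum _ fun σ _ => ?_
    split_ifs with hσ
    · exact tendsto_const_nhds.congr fun N => by rw [hσ, hh1, one_pow]
    · exact tendsto_pow_atTop_nhds_zero_of_norm_lt_one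
        (hh _ (hball σ ζ (torus_subset_closedBall d hζ)) hσ)
  have hlim2 := hlim1.norm
  have hge : (1 : ℝ) ≤ ‖(∑ σ : G, if (σ : CSpace d ≃ₗ[ℂ] CSpace d) ζ = ζ then 1 else 0 : ℂ)‖ := by
    rw [Finset.sum_boole, RCLike.norm_natCast]
    have : 0 < (Finset.univ.filter fun σ : G => (σ : CSpace d ≃ₗ[ℂ] CSpace d) ζ = ζ).card :=
      Finset.card_pos.2 ⟨1, by simp⟩
    exact_mod_cast this
  obtain ⟨N, h1, h2⟩ := ((hlim0.eventually_lt_const (show (0 : ℝ) < 1 / 2 by norm_num)).and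
    (hlim2.eventually_const_lt (show (1 / 2 : ℝ) < _ by linarith))).exists
  refine ⟨p N, hp N, fun z hz => lt_trans (lt_of_le_of_lt ?_ h1) h2⟩
  rw [hpe]
  refine (norm_sum_le _ _).trans (Finset.sum_le_sum fun σ _ => ?_)
  rw [map_pow, norm_pow]
  exact pow_le_pow_left₀ (norm_nonneg _) (hcK σ z hz) N

/-- A basic polynomial map separates the orbits in the torus. -/
theorem IsBasicPolynomialMap.exists_map_eq {d : ℕ} {G : Subgroup (CSpace d ≃ₗ[ℂ] CSpace d)}
    [Fintype G] {θ : Fin d → MvPolynomial (Fin d) ℂ} (hθ : IsBasicPolynomialMap G θ)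
    (hG : ActsOnPolydisc G) {ζ ξ : CSpace d} (hζ : ζ ∈ torus d) (hξ : ξ ∈ torus d)
    (h : polyMap θ ζ = polyMap θ ξ) : ∃ σ : G, (σ : CSpace d ≃ₗ[ℂ] CSpace d) ζ = ξ := by
  by_contra! hne
  obtain ⟨p, hp, hlt⟩ := exists_invariant_peak hG hζ (K := {ξ}) isCompact_singleton
    (Set.singleton_subset_iff.2 (torus_subset_closedBall d hξ)) (by simpa using hne)
  obtain ⟨q, hq⟩ := hθ.exists_eval_eq hp
  have := hlt ξ rfl
  rw [hq, hq, h] at this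
  exact lt_irrefl _ this

/-- The maximum modulus principle of the polydisc. -/
theorem norm_le_of_forall_torus_norm_le {d : ℕ} {f : CSpace d → ℂ}
    (hf : DifferentiableOn ℂ f (polydisc d)) (hc : ContinuousOn f (Metric.closedBall 0 1)) {M : ℝ}
    (hM : ∀ ζ ∈ torus d, ‖f ζ‖ ≤ M) {x : CSpace d} (hx : x ∈ Metric.closedBall (0 : CSpace d) 1) :
    ‖f x‖ ≤ M := by
  have hopen : ∀ x ∈ polydisc d, ‖f x‖ ≤ M := by
    intro x hx
    -- An analytic disc through x: each coordinate is the disc automorphism sending 0 to x_j, so the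
    -- unit circle lands in the torus and the one-variable maximum principle applies.
    let φ : ℂ → CSpace d := fun w j => (w + x j) / (1 + conj (x j) * w)
    have hlt : ∀ (w : ℂ) j, ‖w‖ ≤ 1 → ‖conj (x j) * w‖ < 1 := by
      intro w j hw
      rw [norm_mul, RCLike.norm_conj]
      exact (mul_le_of_le_one_right (norm_nonneg _) hw).trans_lt (hx j)
    have hden : ∀ (w : ℂ) j, ‖w‖ ≤ 1 → 1 + conj (x j) * w ≠ 0 := by
      intro w j hw h0
      have h1 : conj (x j) * w = -1 := by linear_combination h0
      have := hlt w j hw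
      rw [h1] at this
      simp at this
    have hid : ∀ (w : ℂ) j, ‖1 + conj (x j) * w‖ ^ 2 - ‖w + x j‖ ^ 2 =
        (1 - ‖x j‖ ^ 2) * (1 - ‖w‖ ^ 2) := by
      intro w j
      simp only [← Complex.normSq_eq_norm_sq, Complex.normSq_apply]
      simp
      ring
    have hnorm : ∀ (w : ℂ) j, ‖w‖ ≤ 1 → (‖φ w j‖ < 1 ↔ ‖w + x j‖ < ‖1 + conj (x j) * w‖) := by
      intro w j hw
      simp only [φ]
      rw [norm_div, div_lt_one (norm_pos_iff.2 (hden w j hw))]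
    have hxj : ∀ j, 0 < 1 - ‖x j‖ ^ 2 := fun j => by
      have := pow_lt_one₀ (norm_nonneg (x j)) (hx j) two_ne_zero
      linarith
    have hin : ∀ w ∈ Metric.ball (0 : ℂ) 1, φ w ∈ polydisc d := by
      intro w hw j
      rw [mem_ball_zero_iff] at hw
      rw [hnorm w j hw.le]
      refine lt_of_pow_lt_pow_left₀ 2 (norm_nonneg _) ?_
      have h1 := hid w j
      have h2 : 0 < 1 - ‖w‖ ^ 2 := by
        have := pow_lt_one₀ (norm_nonneg w) hw two_ne_zero
        linarith
      nlinarith [mul_pos (hxj j) h2]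
    have hbd : ∀ w ∈ Metric.sphere (0 : ℂ) 1, φ w ∈ torus d := by
      intro w hw j
      rw [mem_sphere_zero_iff_norm] at hw
      have h1 := hid w j
      rw [hw] at h1
      have h2 : ‖1 + conj (x j) * w‖ = ‖w + x j‖ := by
        refine (pow_left_inj₀ (norm_nonneg _) (norm_nonneg _) two_ne_zero).1 ?_
        linarith
      simp only [φ]
      rw [norm_div, h2, div_self]
      rw [← h2]
      exact norm_ne_zero_iff.2 (hden w j hw.le)
    have hφd : ∀ w ∈ Metric.closedBall (0 : ℂ) 1, DifferentiableAt ℂ φ w := by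
      intro w hw
      rw [mem_closedBall_zero_iff] at hw
      refine differentiableAt_pi.2 fun j => ?_
      exact (by fun_prop : DifferentiableAt ℂ (fun w : ℂ => w + x j) w).div (by fun_prop)
        (hden w j hw)
    have hcl : ∀ w ∈ Metric.closedBall (0 : ℂ) 1, φ w ∈ Metric.closedBall (0 : CSpace d) 1 := by
      intro w hw
      rcases (mem_closedBall_zero_iff.1 hw).lt_or_eq with h | h
      · exact Metric.ball_subset_closedBall (polydisc_eq_ball d ▸
          hin w (mem_ball_zero_iff.2 h))
      · exact torus_subset_closedBall d (hbd w (mem_sphere_zero_iff_norm.2 h))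
    have hdc : DiffContOnCl ℂ (fun w => f (φ w)) (Metric.ball 0 1) := by
      refine ⟨hf.comp (fun w hw => (hφd w (Metric.ball_subset_closedBall
        hw)).differentiableWithinAt) hin, ?_⟩
      rw [closure_ball _ one_ne_zero]
      exact hc.comp (fun w hw => (hφd w hw).continuousAt.continuousWithinAt) hcl
    have := Complex.norm_le_of_forall_mem_frontier_norm_le Metric.isBounded_ball hdc
      (C := M) (fun w hw => by
        rw [frontier_ball _ one_ne_zero] at hw
        exact hM _ (hbd w hw)) (z := 0) (subset_closure (by simp))
    have h0 : φ 0 = x := by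
      ext j
      simp [φ]
    simpa only [h0] using this
  have hcl : Metric.closedBall (0 : CSpace d) 1 = closure (polydisc d) := by
    rw [polydisc_eq_ball, closure_ball _ one_ne_zero]
  rw [hcl] at hx hc
  exact le_on_closure hopen hc.norm continuousOn_const hx

theorem closure_polyMap_image_polydisc {d : ℕ} (θ : Fin d → MvPolynomial (Fin d) ℂ) :
    closure (polyMap θ '' polydisc d) = polyMap θ '' Metric.closedBall 0 1 := by
  rw [polydisc_eq_ball, ← closure_ball _ one_ne_zero]
  refine (image_closure_of_isCompact ?_ (continuous_polyMap θ).continuousOn).symm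
  rw [closure_ball _ one_ne_zero]
  exact isCompact_closedBall 0 1

theorem differentiable_eval {d : ℕ} (p : MvPolynomial (Fin d) ℂ) :
    Differentiable ℂ fun z : CSpace d => MvPolynomial.eval z p := fun z =>
  (AnalyticOnNhd.eval_mvPolynomial p z (Set.mem_univ z)).differentiableAt

theorem differentiable_polyMap {d : ℕ} (θ : Fin d → MvPolynomial (Fin d) ℂ) :
    Differentiable ℂ (polyMap θ) :=
  differentiable_pi.2 fun j => differentiable_eval (θ j)

/-- The image of the torus is itself an admissible closed set, by the maximum principle after
composing with θ. Conversely, if a closed S misses θ(ζ), its preimage misses the whole orbit of ζ,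
and an invariant polynomial peaking at that orbit descends to a function whose maximum is not
attained on S. -/
theorem shilovBoundary_polyMap_image {d : ℕ} {G : Subgroup (CSpace d ≃ₗ[ℂ] CSpace d)} [Fintype G]
    (hG : ActsOnPolydisc G) {θ : Fin d → MvPolynomial (Fin d) ℂ} (hθ : IsBasicPolynomialMap G θ) :
    shilovBoundary (polyMap θ '' polydisc d) = polyMap θ '' torus d := by
  have hcompact : IsCompact (polyMap θ '' torus d) :=
    (isCompact_torus d).image (continuous_polyMap θ)
  refine Set.Subset.antisymm (Set.sInter_subset_of_mem ⟨hcompact.isClosed, ?_, ?_⟩) ?_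
  · rw [closure_polyMap_image_polydisc]
    exact Set.image_mono (torus_subset_closedBall d)
  · intro f hfc hfd x hx
    rw [closure_polyMap_image_polydisc] at hx hfc
    obtain ⟨z, hz, rfl⟩ := hx
    have hc : ContinuousOn (fun z => f (polyMap θ z)) (Metric.closedBall 0 1) :=
      hfc.comp (continuous_polyMap θ).continuousOn (Set.mapsTo_image _ _)
    obtain ⟨ζ, hζ, hmax⟩ := (isCompact_torus d).exists_isMaxOn
      ⟨fun _ => 1, fun _ => norm_one⟩ (hc.mono (torus_subset_closedBall d)).norm
    exact ⟨_, Set.mem_image_of_mem _ hζ, norm_le_of_forall_torus_norm_le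
      (hfd.comp (differentiable_polyMap θ).differentiableOn (Set.mapsTo_image _ _)) hc
      (fun ξ hξ => hmax hξ) hz⟩
  · rintro _ ⟨ζ, hζ, rfl⟩ S ⟨hSc, hScl, hS⟩
    by_contra hζS
    rw [closure_polyMap_image_polydisc] at hScl
    obtain ⟨p, hp, hlt⟩ := exists_invariant_peak hG hζ
      (K := Metric.closedBall 0 1 ∩ polyMap θ ⁻¹' S)
      ((isCompact_closedBall 0 1).inter_right (hSc.preimage (continuous_polyMap θ)))
      Set.inter_subset_left (fun σ hσ => hζS (by
        have := hσ.2
        rwa [Set.mem_preimage, hθ.polyMap_map] at this))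
    obtain ⟨q, hq⟩ := hθ.exists_eval_eq hp
    obtain ⟨y, hy, hle⟩ := hS (fun x => MvPolynomial.eval x q)
      (MvPolynomial.continuous_eval q).continuousOn (differentiable_eval q).differentiableOn (polyMap θ ζ) (by
        rw [closure_polyMap_image_polydisc]
        exact Set.mem_image_of_mem _ (torus_subset_closedBall d hζ))
    obtain ⟨z, hz, rfl⟩ := hScl hy
    have := hlt z ⟨hz, hy⟩
    rw [hq, hq] at this
    exact absurd hle this.not_ge

/-! ### The logarithmic symbol as a pointwise and an L² sum. -/

theorem one_sub_mem_slitPlane {w : ℂ} (hw : ‖w‖ ≤ 1) (h : w ≠ 1) :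
    1 - w ∈ Complex.slitPlane := by
  refine Complex.mem_slitPlane_iff.2 (Or.inl ?_)
  have h1 : w.re ≤ 1 := (Complex.re_le_norm w).trans hw
  refine lt_of_le_of_ne (by simpa using h1) fun h2 => h ?_
  have hre : w.re = 1 := by
    simp only [Complex.sub_re, Complex.one_re] at h2
    linarith
  have h4 : ‖w‖ ^ 2 ≤ 1 := pow_le_one₀ (norm_nonneg _) hw
  rw [← Complex.normSq_eq_norm_sq, Complex.normSq_apply, hre] at h4
  have him : w.im * w.im = 0 := by nlinarith [mul_self_nonneg w.im]
  exact Complex.ext hre (by simpa using him)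

/-- Dirichlet's test gives convergence on the circle away from 1, and Abel's theorem identifies the
sum. The term n = 0 is 0 because division by 0 gives 0. -/
theorem tendsto_sum_pow_div_log {w : ℂ} (hw : ‖w‖ = 1) (h : w ≠ 1) :
    Tendsto (fun N : ℕ => ∑ n ∈ Finset.range (N + 1), w ^ n / n) atTop
      (𝓝 (-Complex.log (1 - w))) := by
  have hb : ∀ n, ‖∑ k ∈ Finset.range n, w ^ (k + 1)‖ ≤ 2 / ‖w - 1‖ := by
    intro n
    have : ∑ k ∈ Finset.range n, w ^ (k + 1) = w * ((w ^ n - 1) / (w - 1)) := by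
      rw [← geom_sum_eq h, Finset.mul_sum]
      simp only [pow_succ']
    rw [this, norm_mul, hw, one_mul, norm_div]
    gcongr
    refine (norm_sub_le _ _).trans ?_
    rw [norm_pow, hw]
    norm_num
  have hanti : Antitone fun n : ℕ => (1 : ℝ) / (n + 1) := fun a b hab => by
    dsimp only
    gcongr
  obtain ⟨l, hl⟩ := cauchySeq_tendsto_of_complete
    (hanti.cauchySeq_series_mul_of_tendsto_zero_of_bounded
      tendsto_one_div_add_atTop_nhds_zero_nat hb)
  have hl' : Tendsto (fun N : ℕ => ∑ n ∈ Finset.range (N + 1), w ^ n / n) atTop (𝓝 l) := by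
    refine hl.congr fun N => ?_
    rw [Finset.sum_range_succ']
    simp [div_eq_inv_mul]
  have habel := Complex.tendsto_tsum_powerSeries_nhdsWithin_lt
    ((tendsto_add_atTop_iff_nat (f := fun N => ∑ n ∈ Finset.range N, w ^ n / (n : ℂ)) 1).1 hl')
  rw [tendsto_map'_iff] at habel
  have hlog : Tendsto (fun x : ℝ => -Complex.log (1 - w * x)) (𝓝[<] 1)
      (𝓝 (-Complex.log (1 - w))) := by
    have hc : ContinuousAt (fun x : ℝ => -Complex.log (1 - w * x)) 1 := by
      refine ContinuousAt.neg (ContinuousAt.clog (by fun_prop) ?_)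
      simpa using one_sub_mem_slitPlane hw.le h
    have := hc.tendsto.mono_left (nhdsWithin_le_nhds (s := Set.Iio 1))
    simpa using this
  have heq : l = -Complex.log (1 - w) := by
    refine tendsto_nhds_unique habel (hlog.congr' ?_)
    filter_upwards [Ioo_mem_nhdsLT (zero_lt_one' ℝ)] with x hx
    have hx1 : ‖w * (x : ℂ)‖ < 1 := by
      rw [norm_mul, hw, one_mul, Complex.norm_real, Real.norm_of_nonneg hx.1.le]
      exact hx.2
    rw [← (Complex.hasSum_taylorSeries_neg_log hx1).tsum_eq]
    refine tsum_congr fun n => ?_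
    rw [mul_pow]
    ring
  exact heq ▸ hl'

/-- The function `∑_{n ≥ 1} z_iⁿ conj(z_j)ⁿ / n` in closed form. -/
noncomputable def logSymbol {d : ℕ} (i j : Fin d) (z : CSpace d) : ℂ :=
  -Complex.log (1 - z i * conj (z j))

theorem measurable_logSymbol {d : ℕ} (i j : Fin d) :
    Measurable (logSymbol i j : CSpace d → ℂ) := by
  unfold logSymbol
  have : Measurable fun z : CSpace d => 1 - z i * conj (z j) :=
    (by fun_prop : Continuous fun z : CSpace d => 1 - z i * conj (z j)).measurable
  exact (Complex.measurable_log.comp this).neg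

theorem continuous_partialSymbol {d : ℕ} (i j : Fin d) (N : ℕ) :
    Continuous (partialSymbol i j N : CSpace d → ℂ) := by
  unfold partialSymbol
  fun_prop

theorem partialSymbol_eq_sum_range {d : ℕ} (i j : Fin d) (N : ℕ) (z : CSpace d) :
    partialSymbol i j N z = ∑ n ∈ Finset.range (N + 1), (z i * conj (z j)) ^ n / n := by
  rw [Finset.sum_range_succ', partialSymbol, Finset.range_eq_Ico,
    Finset.sum_Ico_add' (fun n : ℕ => (z i * conj (z j)) ^ n / (n : ℂ)) 0 N 1]
  simp only [Nat.cast_zero, div_zero, add_zero, zero_add]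
  refine Finset.sum_congr rfl fun n _ => ?_
  rw [mul_pow]
  ring

theorem tendsto_partialSymbol {d : ℕ} (i j : Fin d) {z : CSpace d} (hz : z ∈ torus d)
    (h : z i * conj (z j) ≠ 1) :
    Tendsto (fun N => partialSymbol i j N z) atTop (𝓝 (logSymbol i j z)) := by
  simp only [partialSymbol_eq_sum_range]
  exact tendsto_sum_pow_div_log (by rw [norm_mul, RCLike.norm_conj, hz i, hz j, one_mul]) h

/-- The map t ↦ t_i - t_j is a continuous surjective homomorphism, so it carries Haar measure to
Haar measure, for which a point is null. -/
theorem ae_mul_conj_ne_one {d : ℕ} {i j : Fin d} (hij : i ≠ j) :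
    ∀ᵐ z ∂(torusMeasure d), z i * conj (z j) ≠ 1 := by
  have hm : MeasurableSet {z : CSpace d | z i * conj (z j) ≠ 1} :=
    (isOpen_ne_fun (by fun_prop) continuous_const).measurableSet
  rw [torusMeasure, ae_map_iff continuous_torusPoint.aemeasurable hm]
  let f : UnitAddTorus (Fin d) →+ UnitAddCircle :=
    Pi.evalAddMonoidHom (fun _ : Fin d => UnitAddCircle) i - Pi.evalAddMonoidHom _ j
  have hf : MeasurePreserving f (Measure.pi fun _ => AddCircle.haarAddCircle)
      AddCircle.haarAddCircle := by
    refine AddMonoidHom.measurePreserving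
      (show Continuous fun t : UnitAddTorus (Fin d) => t i - t j by fun_prop) (fun s => ?_)
      (by simp)
    exact ⟨Pi.single i s, by simp [f, hij.symm]⟩
  have h0 : ∀ᵐ s ∂(AddCircle.haarAddCircle : Measure UnitAddCircle), s ≠ 0 := by
    have h1 : (AddCircle.haarAddCircle : Measure UnitAddCircle) {0} = 0 := by
      have h2 := AddCircle.volume_closedBall (T := 1) (x := 0) 0
      rw [AddCircle.volume_eq_smul_haarAddCircle] at h2
      simpa using h2
    simpa [ae_iff] using h1
  filter_upwards [hf.quasiMeasurePreserving.ae h0] with t ht h1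
  refine ht (AddCircle.injective_toCircle (T := 1) one_ne_zero ?_)
  have h2 : f t = t i + -t j := by simp [f, sub_eq_add_neg]
  rw [h2, AddCircle.toCircle_add, AddCircle.toCircle_neg, AddCircle.toCircle_zero]
  ext
  rw [Circle.coe_mul, Circle.coe_inv_eq_conj]
  exact h1

/-- The Haar measure of `(ℝ/ℤ)^d`. -/
noncomputable abbrev addTorusMeasure (d : ℕ) : Measure (UnitAddTorus (Fin d)) :=
  Measure.pi fun _ => AddCircle.haarAddCircle

theorem orthonormal_mFourier_addTorus (d : ℕ) : Orthonormal ℂ (fun k : Fin d → ℤ =>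
    ContinuousMap.toLp (E := ℂ) 2 (addTorusMeasure d) ℂ (UnitAddTorus.mFourier k)) :=
  UnitAddTorus.orthonormal_mFourier

theorem mFourier_apply_eq_prod {d : ℕ} (k : Fin d → ℤ) (t : UnitAddTorus (Fin d)) :
    UnitAddTorus.mFourier k t = ∏ l, torusPoint t l ^ k l := by
  simp [UnitAddTorus.mFourier, torusPoint, fourier_apply, AddCircle.toCircle_zsmul]

/-- The frequency of the character `z_i conj(z_j)`. -/
def shiftFreq {d : ℕ} (i j : Fin d) : Fin d → ℤ := Pi.single i 1 - Pi.single j 1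

theorem mFourier_smul_shiftFreq {d : ℕ} (i j : Fin d) (n : ℕ) (t : UnitAddTorus (Fin d)) :
    UnitAddTorus.mFourier ((n : ℤ) • shiftFreq i j) t =
      (torusPoint t i * conj (torusPoint t j)) ^ n := by
  have h1 : UnitAddTorus.mFourier (shiftFreq i j) t = torusPoint t i * conj (torusPoint t j) := by
    rw [shiftFreq, sub_eq_add_neg, UnitAddTorus.mFourier_add, UnitAddTorus.mFourier_neg,
      UnitAddTorus.mFourier_single, UnitAddTorus.mFourier_single]
    simp [torusPoint]
  induction n with
  | zero => simp [UnitAddTorus.mFourier_zero]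
  | succ n ih =>
    rw [Nat.cast_succ, add_smul, UnitAddTorus.mFourier_add, ih, one_smul, h1, pow_succ]

/-- The partial sums as continuous functions on `(ℝ/ℤ)^d`. -/
noncomputable def partialSymbolMap {d : ℕ} (i j : Fin d) (N : ℕ) : C(UnitAddTorus (Fin d), ℂ) :=
  ∑ n ∈ Finset.Icc 1 N, (1 / (n : ℂ)) • UnitAddTorus.mFourier ((n : ℤ) • shiftFreq i j)

theorem partialSymbolMap_apply {d : ℕ} (i j : Fin d) (N : ℕ) (t : UnitAddTorus (Fin d)) :
    partialSymbolMap i j N t = partialSymbol i j N (torusPoint t) := by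
  simp only [partialSymbolMap, partialSymbol, ContinuousMap.coe_sum, Finset.sum_apply,
    ContinuousMap.smul_apply, mFourier_smul_shiftFreq, smul_eq_mul, mul_pow, mul_assoc]

/-- The frequencies n(e_i - e_j) are distinct, so the characters are orthonormal, and the
coefficients 1/n are square summable. -/
theorem exists_tendsto_partialSymbolMap {d : ℕ} {i j : Fin d} (hij : i ≠ j) :
    ∃ f : Lp ℂ 2 (addTorusMeasure d), Tendsto (fun N : ℕ =>
      ContinuousMap.toLp (E := ℂ) 2 (addTorusMeasure d) ℂ (partialSymbolMap i j N)) atTop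
        (𝓝 f) := by
  have hinj : Function.Injective fun n : ℕ => (n : ℤ) • shiftFreq i j := by
    intro a b hab
    have := congrFun hab i
    simpa [shiftFreq, hij] using this
  have horth := (orthonormal_mFourier_addTorus d).comp _ hinj
  have hsum : Summable fun n : ℕ => ‖(1 / (n : ℂ))‖ ^ 2 := by
    have := Real.summable_one_div_nat_pow.2 one_lt_two
    refine this.congr fun n => ?_
    simp
  have hs := (horth.orthogonalFamily.summable_iff_norm_sq_summable
    fun n : ℕ => (1 / (n : ℂ))).2 hsum
  obtain ⟨f, hf⟩ := hs
  refine ⟨f, ((tendsto_add_atTop_iff_nat 1).2 hf.tendsto_sum_nat).congr fun N => ?_⟩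
  rw [Finset.sum_range_succ', partialSymbolMap, map_sum, Finset.range_eq_Ico,
    Finset.sum_Ico_add' (fun n : ℕ => LinearIsometry.toSpanSingleton ℂ _ _ (1 / (n : ℂ))) 0 N 1]
  simp
  rfl

/-- The L² limit is identified with the closed form along a subsequence that converges almost
everywhere. -/
theorem tendsto_eLpNorm_partialSymbol {d : ℕ} {i j : Fin d} (hij : i ≠ j) :
    Tendsto (fun N => eLpNorm (fun ζ => logSymbol i j ζ - partialSymbol i j N ζ) 2
      (torusMeasure d)) atTop (𝓝 0) := by
  obtain ⟨f, hf⟩ := exists_tendsto_partialSymbolMap hij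
  rw [Lp.tendsto_Lp_iff_tendsto_eLpNorm'] at hf
  have hf2 : Tendsto (fun N => eLpNorm (⇑(partialSymbolMap i j N) - ⇑f) 2 (addTorusMeasure d))
      atTop (𝓝 0) := by
    refine hf.congr fun N => eLpNorm_congr_ae ?_
    exact (ContinuousMap.coeFn_toLp _ _).sub (ae_eq_refl _)
  obtain ⟨ns, hns, hae⟩ := (tendstoInMeasure_of_tendsto_eLpNorm two_ne_zero
    (fun N => (partialSymbolMap i j N).continuous.aestronglyMeasurable)
    (Lp.aestronglyMeasurable f) hf2).exists_seq_tendsto_ae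
  have hlog : ∀ᵐ t ∂(addTorusMeasure d), f t = logSymbol i j (torusPoint t) := by
    filter_upwards [hae, ae_of_ae_map continuous_torusPoint.aemeasurable (ae_mul_conj_ne_one hij)]
      with t ht h1
    refine tendsto_nhds_unique ht ?_
    simp only [partialSymbolMap_apply]
    exact (tendsto_partialSymbol i j (torusPoint_mem_torus t) h1).comp hns.tendsto_atTop
  refine hf2.congr fun N => ?_
  have hm : Measurable fun ζ : CSpace d => logSymbol i j ζ - partialSymbol i j N ζ :=
    (measurable_logSymbol i j).sub (continuous_partialSymbol i j N).measurable
  rw [torusMeasure, eLpNorm_map_measure hm.aestronglyMeasurable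
    continuous_torusPoint.aemeasurable, ← eLpNorm_neg]
  refine eLpNorm_congr_ae ?_
  filter_upwards [hlog] with t ht
  simp [partialSymbolMap_apply, ht]

/-! ### The Hankel estimate on the torus, by frequencies in one variable. -/

/-- The restriction of a polynomial to the torus, as a continuous function on `(ℝ/ℤ)^d`. -/
noncomputable def torusEval {d : ℕ} (p : MvPolynomial (Fin d) ℂ) : C(UnitAddTorus (Fin d), ℂ) :=
  ⟨fun t => MvPolynomial.eval (torusPoint t) p,
    (MvPolynomial.continuous_eval p).comp continuous_torusPoint⟩

theorem torusEval_add {d : ℕ} (p q : MvPolynomial (Fin d) ℂ) :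
    torusEval (p + q) = torusEval p + torusEval q := by
  ext t
  simp [torusEval]

theorem torusEval_monomial {d : ℕ} (α : Fin d →₀ ℕ) (c : ℂ) :
    torusEval (MvPolynomial.monomial α c) = c • UnitAddTorus.mFourier fun l => (α l : ℤ) := by
  ext t
  simp [torusEval, mFourier_apply_eq_prod, MvPolynomial.eval_monomial, Finsupp.prod_fintype]

theorem torusEval_sum {d : ℕ} {ι : Type*} (s : Finset ι) (p : ι → MvPolynomial (Fin d) ℂ) :
    torusEval (∑ n ∈ s, p n) = ∑ n ∈ s, torusEval (p n) := by
  ext t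
  simp [torusEval]

theorem mFourier_mul {d : ℕ} (k l : Fin d → ℤ) :
    UnitAddTorus.mFourier k * UnitAddTorus.mFourier l = UnitAddTorus.mFourier (k + l) := by
  ext t
  simp [UnitAddTorus.mFourier_add]

/-- The span of the characters with negative frequency in the variable `j`. -/
noncomputable def negFreq {d : ℕ} (j : Fin d) : Submodule ℂ C(UnitAddTorus (Fin d), ℂ) :=
  Submodule.span ℂ (UnitAddTorus.mFourier '' {k | k j < 0})

/-- The span of the characters with nonnegative frequency in the variable `j`. -/
noncomputable def nonnegFreq {d : ℕ} (j : Fin d) : Submodule ℂ C(UnitAddTorus (Fin d), ℂ) :=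
  Submodule.span ℂ (UnitAddTorus.mFourier '' {k | 0 ≤ k j})

/-- Pythagoras, since characters with different frequencies are orthogonal. -/
theorem norm_toLp_le_of_freq {d : ℕ} {j : Fin d} {f g : C(UnitAddTorus (Fin d), ℂ)}
    (hf : f ∈ negFreq j) (hg : g ∈ nonnegFreq j) :
    ‖ContinuousMap.toLp (E := ℂ) 2 (addTorusMeasure d) ℂ f‖ ≤
      ‖ContinuousMap.toLp (E := ℂ) 2 (addTorusMeasure d) ℂ (f + g)‖ := by
  set L := ContinuousMap.toLp (E := ℂ) 2 (addTorusMeasure d) ℂ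
  have hf' := Submodule.mem_map_of_mem (f := L.toLinearMap) hf
  have hg' := Submodule.mem_map_of_mem (f := L.toLinearMap) hg
  rw [negFreq, Submodule.map_span] at hf'
  rw [nonnegFreq, Submodule.map_span] at hg'
  have horth : inner ℂ (L f) (L g) = 0 := by
    refine (Submodule.isOrtho_iff_inner_eq.1 (Submodule.isOrtho_span.2 ?_)) _ hf' _ hg'
    rintro _ ⟨_, ⟨k, hk, rfl⟩, rfl⟩ _ ⟨_, ⟨l, hl, rfl⟩, rfl⟩
    refine (orthonormal_mFourier_addTorus d).2 fun h => ?_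
    simp only [Set.mem_ofPred_eq] at hk hl
    rw [h] at hk
    exact absurd hl hk.not_ge
  have h1 := norm_add_sq_eq_norm_sq_add_norm_sq_of_inner_eq_zero _ _ horth
  rw [← map_add] at h1
  refine pow_le_pow_iff_left₀ (norm_nonneg _) (norm_nonneg _) two_ne_zero |>.1 ?_
  nlinarith [mul_self_nonneg ‖L g‖]

/-- The part of `∑ z_iⁿ conj(z_j)ⁿ Q / n` with nonnegative frequencies is a polynomial. -/
theorem exists_analytic_part {d : ℕ} {i j : Fin d} (hij : i ≠ j) (Q : MvPolynomial (Fin d) ℂ) :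
    ∃ (R : MvPolynomial (Fin d) ℂ) (N₀ : ℕ), ∀ N ≥ N₀,
      partialSymbolMap i j N * torusEval Q - torusEval R ∈ negFreq j ∧
      torusEval R - star (partialSymbolMap i j N) * torusEval Q ∈ nonnegFreq j := by
  induction Q using MvPolynomial.induction_on' with
  | monomial α c =>
    let a : Fin d → ℤ := fun l => (α l : ℤ)
    let F : ℕ → C(UnitAddTorus (Fin d), ℂ) := fun n =>
      (1 / (n : ℂ) * c) • UnitAddTorus.mFourier ((n : ℤ) • shiftFreq i j + a)
    have hfreq : ∀ n : ℕ, ((n : ℤ) • shiftFreq i j + a) j = α j - n := by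
      intro n
      simp only [a, shiftFreq, Pi.add_apply, Pi.smul_apply, Pi.sub_apply, Pi.single_eq_same,
        Pi.single_eq_of_ne hij.symm, smul_eq_mul]
      ring
    -- The n-th term moves the exponent of z_j from α_j to α_j - n, so the terms with n ≤ α_j stay
    -- analytic. In this range the truncated subtraction of exponents is exact.
    let R : MvPolynomial (Fin d) ℂ := ∑ n ∈ Finset.Ioc 0 (α j), MvPolynomial.monomial
      (α - Finsupp.single j n + Finsupp.single i n) (1 / (n : ℂ) * c)
    have hR : torusEval R = ∑ n ∈ Finset.Ioc 0 (α j), F n := by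
      rw [torusEval_sum]
      refine Finset.sum_congr rfl fun n hn => ?_
      rw [torusEval_monomial]
      congr 2
      ext l
      have hn' := (Finset.mem_Ioc.1 hn).2
      by_cases hlj : l = j
      · subst hlj
        rw [hfreq]
        simp [hij, hn', Nat.cast_sub]
      · by_cases hli : l = i
        · subst hli
          simp [a, shiftFreq, hlj, add_comm]
        · simp [a, shiftFreq, hlj, hli]
    have hprod : ∀ N, partialSymbolMap i j N * torusEval (MvPolynomial.monomial α c) =
        ∑ n ∈ Finset.Ioc 0 N, F n := by
      intro N
      rw [partialSymbolMap, torusEval_monomial, Finset.sum_mul]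
      refine Finset.sum_congr rfl fun n _ => ?_
      rw [smul_mul_smul_comm, mFourier_mul]
    refine ⟨R, α j, fun N hN => ⟨?_, ?_⟩⟩
    · rw [hR, hprod, ← Finset.sum_Ioc_consecutive F (Nat.zero_le _) hN, add_sub_cancel_left]
      refine sum_mem fun n hn => Submodule.smul_mem _ _ (Submodule.subset_span ⟨_, ?_, rfl⟩)
      have := (Finset.mem_Ioc.1 hn).1
      simp only [Set.mem_ofPred_eq, hfreq]
      omega
    · rw [hR]
      refine sub_mem (sum_mem fun n hn => Submodule.smul_mem _ _
        (Submodule.subset_span ⟨_, ?_, rfl⟩)) ?_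
      · have := (Finset.mem_Ioc.1 hn).2
        simp only [Set.mem_ofPred_eq, hfreq]
        omega
      -- Conjugated terms raise the frequency in z_j to α_j + n, so none of them needs to be
      -- removed.
      · rw [partialSymbolMap, torusEval_monomial, star_sum, Finset.sum_mul]
        refine sum_mem fun n _ => ?_
        have hstar : star (UnitAddTorus.mFourier ((n : ℤ) • shiftFreq i j)) =
            UnitAddTorus.mFourier (-((n : ℤ) • shiftFreq i j)) := by
          ext t
          simp [UnitAddTorus.mFourier_neg]
        rw [star_smul, hstar, smul_mul_smul_comm, mFourier_mul]
        refine Submodule.smul_mem _ _ (Submodule.subset_span ⟨_, ?_, rfl⟩)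
        simp only [Set.mem_ofPred_eq, shiftFreq, Pi.add_apply, Pi.neg_apply, Pi.smul_apply,
          Pi.sub_apply, Pi.single_eq_same, Pi.single_eq_of_ne hij.symm, smul_eq_mul]
        omega
  | add p q hp hq =>
    obtain ⟨R, M, hR⟩ := hp
    obtain ⟨S, N, hS⟩ := hq
    refine ⟨R + S, max M N, fun n hn => ?_⟩
    obtain ⟨h1, h2⟩ := hR n ((le_max_left _ _).trans hn)
    obtain ⟨h3, h4⟩ := hS n ((le_max_right _ _).trans hn)
    rw [torusEval_add, torusEval_add]
    constructor
    · convert! add_mem h1 h3 using 1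
      ring
    · convert! add_mem h2 h4 using 1
      ring

theorem eLpNorm_torusMeasure {d : ℕ} {f : CSpace d → ℂ} (hf : Measurable f) :
    eLpNorm f 2 (torusMeasure d) = eLpNorm (fun t => f (torusPoint t)) 2 (addTorusMeasure d) := by
  rw [torusMeasure, eLpNorm_map_measure hf.aestronglyMeasurable
    continuous_torusPoint.aemeasurable]
  rfl

theorem exists_bound_on_torus {d : ℕ} (q : MvPolynomial (Fin d) ℂ) :
    ∃ C : ℝ, ∀ ζ ∈ torus d, ‖MvPolynomial.eval ζ q‖ ≤ C :=
  (isCompact_torus d).exists_bound_of_continuousOn (MvPolynomial.continuous_eval q).continuousOn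

/-- The imaginary part of the symbol is minus an argument. This is the source of the constant 2π in
the Hankel bound. -/
theorem norm_logSymbol_sub_conj_le {d : ℕ} (i j : Fin d) (ζ : CSpace d) :
    ‖logSymbol i j ζ - conj (logSymbol i j ζ)‖ ≤ 2 * Real.pi := by
  rw [Complex.sub_conj, logSymbol, norm_mul, Complex.norm_I, mul_one, Complex.norm_real,
    Real.norm_eq_abs, abs_mul, abs_two, Complex.neg_im, abs_neg, Complex.log_im]
  have := Complex.abs_arg_le_pi (1 - ζ i * conj (ζ j))
  gcongr

theorem eLpNorm_partialSymbol_mul_sub_le {d : ℕ} {i j : Fin d} {N : ℕ}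
    {Q R : MvPolynomial (Fin d) ℂ}
    (h1 : partialSymbolMap i j N * torusEval Q - torusEval R ∈ negFreq j)
    (h2 : torusEval R - star (partialSymbolMap i j N) * torusEval Q ∈ nonnegFreq j) :
    eLpNorm (fun ζ => partialSymbol i j N ζ * MvPolynomial.eval ζ Q - MvPolynomial.eval ζ R) 2
        (torusMeasure d) ≤
      eLpNorm (fun ζ => (partialSymbol i j N ζ - conj (partialSymbol i j N ζ)) *
        MvPolynomial.eval ζ Q) 2 (torusMeasure d) := by
  have hc := continuous_partialSymbol (d := d) i j N
  have hQ := MvPolynomial.continuous_eval Q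
  have hR := MvPolynomial.continuous_eval R
  have hm1 : Continuous fun ζ : CSpace d =>
    partialSymbol i j N ζ * MvPolynomial.eval ζ Q - MvPolynomial.eval ζ R := by fun_prop
  have hm2 : Continuous fun ζ : CSpace d =>
    (partialSymbol i j N ζ - conj (partialSymbol i j N ζ)) * MvPolynomial.eval ζ Q := by fun_prop
  rw [eLpNorm_torusMeasure hm1.measurable, eLpNorm_torusMeasure hm2.measurable]
  have h := norm_toLp_le_of_freq h1 h2
  rw [sub_add_sub_cancel, Lp.norm_def, Lp.norm_def, ENNReal.toReal_le_toReal
    (Lp.eLpNorm_ne_top _) (Lp.eLpNorm_ne_top _), eLpNorm_congr_ae (ContinuousMap.coeFn_toLp _ _),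
    eLpNorm_congr_ae (ContinuousMap.coeFn_toLp _ _)] at h
  convert! h using 2
  · ext t
    simp [partialSymbolMap_apply, torusEval]
  · ext t
    simp [partialSymbolMap_apply, torusEval, sub_mul]

/-- The same R serves all large N, so the inequality for partial sums passes to the limit. The bound
on the imaginary part is used only for the full sum. -/
theorem exists_polynomial_eLpNorm_sub_le {d : ℕ} {i j : Fin d} (hij : i ≠ j)
    (Q : MvPolynomial (Fin d) ℂ) :
    ∃ R : MvPolynomial (Fin d) ℂ,
      eLpNorm (fun ζ => logSymbol i j ζ * MvPolynomial.eval ζ Q - MvPolynomial.eval ζ R) 2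
        (torusMeasure d) ≤
      ENNReal.ofReal (2 * Real.pi) *
        eLpNorm (fun ζ => MvPolynomial.eval ζ Q) 2 (torusMeasure d) := by
  obtain ⟨R, N₀, hR⟩ := exists_analytic_part hij Q
  obtain ⟨B, hB⟩ := exists_bound_on_torus Q
  refine ⟨R, ?_⟩
  set ν := torusMeasure d
  set ε : ℕ → ℝ≥0∞ := fun N =>
    eLpNorm (fun ζ => logSymbol i j ζ - partialSymbol i j N ζ) 2 ν with hε
  have hεlim : Tendsto ε atTop (𝓝 0) := tendsto_eLpNorm_partialSymbol hij
  set K := ENNReal.ofReal (2 * Real.pi) * eLpNorm (fun ζ => MvPolynomial.eval ζ Q) 2 ν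
  -- Three errors of size Bε_N arise: one from replacing φ by φ_N on the left, two from replacing
  -- φ_N and its conjugate by φ and its conjugate on the right.
  have hlim : Tendsto (fun N => 3 * (ENNReal.ofReal B * ε N) + K) atTop (𝓝 K) := by
    have h1 := ENNReal.Tendsto.const_mul (a := 3)
      (ENNReal.Tendsto.const_mul (a := ENNReal.ofReal B) hεlim (Or.inr ENNReal.ofReal_ne_top))
      (Or.inr (by simp))
    simpa using h1.add_const K
  have hmQ : Measurable fun ζ : CSpace d => MvPolynomial.eval ζ Q :=
    (MvPolynomial.continuous_eval Q).measurable
  have hmR : Measurable fun ζ : CSpace d => MvPolynomial.eval ζ R :=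
    (MvPolynomial.continuous_eval R).measurable
  have hml := measurable_logSymbol (d := d) i j
  have hconj : Measurable (fun z : ℂ => conj z) := Complex.continuous_conj.measurable
  refine ge_of_tendsto hlim ?_
  filter_upwards [eventually_ge_atTop N₀] with N hN
  obtain ⟨h1, h2⟩ := hR N hN
  have hmp := (continuous_partialSymbol (d := d) i j N).measurable
  have hd : ∀ u : CSpace d → ℂ,
      (∀ ζ, ‖u ζ‖ = ‖logSymbol i j ζ - partialSymbol i j N ζ‖) →
      eLpNorm (fun ζ => u ζ * MvPolynomial.eval ζ Q) 2 ν ≤ ENNReal.ofReal B * ε N := by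
    intro u hu
    refine eLpNorm_le_mul_eLpNorm_of_ae_le_mul ?_ 2
    filter_upwards [ae_mem_torus d] with ζ hζ
    rw [norm_mul, hu, mul_comm]
    exact mul_le_mul_of_nonneg_right (hB ζ hζ) (norm_nonneg _)
  have e1 : eLpNorm (fun ζ => logSymbol i j ζ * MvPolynomial.eval ζ Q - MvPolynomial.eval ζ R) 2 ν
      ≤ ENNReal.ofReal B * ε N + eLpNorm (fun ζ => partialSymbol i j N ζ * MvPolynomial.eval ζ Q -
        MvPolynomial.eval ζ R) 2 ν := by
    refine le_trans (le_of_eq_of_le ?_ (eLpNorm_add_le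
      (f := fun ζ => (logSymbol i j ζ - partialSymbol i j N ζ) * MvPolynomial.eval ζ Q)
      (g := fun ζ => partialSymbol i j N ζ * MvPolynomial.eval ζ Q - MvPolynomial.eval ζ R)
      ((hml.sub hmp).mul hmQ).aestronglyMeasurable
      ((hmp.mul hmQ).sub hmR).aestronglyMeasurable (by norm_num)))
      (add_le_add_left (hd _ fun _ => rfl) _)
    congr 1
    ext ζ
    simp only [Pi.add_apply]
    ring
  have e2 : eLpNorm (fun ζ => (partialSymbol i j N ζ - conj (partialSymbol i j N ζ)) *
        MvPolynomial.eval ζ Q) 2 ν ≤ (ENNReal.ofReal B * ε N + ENNReal.ofReal B * ε N) + K := by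
    refine le_trans (le_of_eq_of_le ?_ (eLpNorm_add_le
      (f := (fun ζ => (partialSymbol i j N ζ - logSymbol i j ζ) * MvPolynomial.eval ζ Q) +
        fun ζ => conj (logSymbol i j ζ - partialSymbol i j N ζ) * MvPolynomial.eval ζ Q)
      (g := fun ζ => (logSymbol i j ζ - conj (logSymbol i j ζ)) * MvPolynomial.eval ζ Q)
      (((hmp.sub hml).mul hmQ).add ((hconj.comp (hml.sub hmp)).mul hmQ)).aestronglyMeasurable
      ((hml.sub (hconj.comp hml)).mul hmQ).aestronglyMeasurable (by norm_num)))
      (add_le_add ((eLpNorm_add_le ((hmp.sub hml).mul hmQ).aestronglyMeasurable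
        ((hconj.comp (hml.sub hmp)).mul hmQ).aestronglyMeasurable (by norm_num)).trans
        (add_le_add (hd _ fun _ => norm_sub_rev _ _) (hd _ fun _ => RCLike.norm_conj _))) ?_)
    · congr 1
      ext ζ
      simp only [Pi.add_apply, map_sub]
      ring
    · refine eLpNorm_le_mul_eLpNorm_of_ae_le_mul (Eventually.of_forall fun ζ => ?_) 2
      rw [norm_mul]
      exact mul_le_mul_of_nonneg_right (norm_logSymbol_sub_conj_le i j ζ) (norm_nonneg _)
  calc _ ≤ _ := e1
    _ ≤ ENNReal.ofReal B * ε N + (ENNReal.ofReal B * ε N + ENNReal.ofReal B * ε N + K) :=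
      add_le_add_right ((eLpNorm_partialSymbol_mul_sub_le h1 h2).trans e2) _
    _ = 3 * (ENNReal.ofReal B * ε N) + K := by ring

/-! ### Averaging over G and descent to the quotient. -/

theorem ActsOnPolydisc.measurePreserving {d : ℕ} {G : Subgroup (CSpace d ≃ₗ[ℂ] CSpace d)}
    (hG : ActsOnPolydisc G) (σ : G) : MeasurePreserving (σ : CSpace d ≃ₗ[ℂ] CSpace d)
      (torusMeasure d) (torusMeasure d) :=
  measurePreserving_of_norm_map _ (hG.norm_map σ.2)

/-- The triangle inequality and invariance of Haar measure. With c = 1 it controls the averaged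
symbol, with c = ρ⁻¹ the projection onto relative invariants. -/
theorem eLpNorm_average_le {d : ℕ} {G : Subgroup (CSpace d ≃ₗ[ℂ] CSpace d)} [Fintype G]
    (hG : ActsOnPolydisc G) {c : G → ℂ} (hc : ∀ σ, ‖c σ‖ = 1) {u : CSpace d → ℂ}
    (hu : Measurable u) :
    eLpNorm (fun ζ => (Fintype.card G : ℂ)⁻¹ *
      ∑ σ : G, c σ * u ((σ : CSpace d ≃ₗ[ℂ] CSpace d) ζ)) 2 (torusMeasure d) ≤
      eLpNorm u 2 (torusMeasure d) := by
  have hm : ∀ σ : G, Measurable fun ζ => c σ * u ((σ : CSpace d ≃ₗ[ℂ] CSpace d) ζ) :=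
    fun σ => (hu.comp (hG.measurePreserving σ).measurable).const_mul (c σ)
  have h1 : eLpNorm (∑ σ : G, fun ζ => c σ * u ((σ : CSpace d ≃ₗ[ℂ] CSpace d) ζ)) 2
      (torusMeasure d) ≤ Fintype.card G * eLpNorm u 2 (torusMeasure d) := by
    refine (eLpNorm_sum_le (fun σ _ => (hm σ).aestronglyMeasurable) (by norm_num)).trans ?_
    refine (Finset.sum_le_card_nsmul _ _ (eLpNorm u 2 (torusMeasure d)) fun σ _ => ?_).trans ?_
    · rw [← eLpNorm_comp_measurePreserving hu.aestronglyMeasurable (hG.measurePreserving σ)]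
      refine eLpNorm_mono fun ζ => ?_
      rw [norm_mul, hc, one_mul, Function.comp_apply]
    · rw [Finset.card_univ, nsmul_eq_mul]
  have h2 : (fun ζ => (Fintype.card G : ℂ)⁻¹ *
      ∑ σ : G, c σ * u ((σ : CSpace d ≃ₗ[ℂ] CSpace d) ζ)) = (Fintype.card G : ℂ)⁻¹ •
      (∑ σ : G, fun ζ => c σ * u ((σ : CSpace d ≃ₗ[ℂ] CSpace d) ζ)) := by
    ext ζ
    simp [Finset.sum_apply]
  have h0 : (Fintype.card G : ℝ≥0∞) ≠ 0 := by simp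
  rw [h2, eLpNorm_const_smul, enorm_inv (by simp)]
  have h3 : ‖(Fintype.card G : ℂ)‖ₑ = (Fintype.card G : ℝ≥0∞) := by
    rw [← ofReal_norm, RCLike.norm_natCast, ENNReal.ofReal_natCast]
  rw [h3]
  refine (mul_le_mul_right h1 _).trans ?_
  rw [← mul_assoc, ENNReal.inv_mul_cancel h0 (by simp), one_mul]

theorem memLp_logSymbol {d : ℕ} {i j : Fin d} (hij : i ≠ j) :
    MemLp (logSymbol i j) 2 (torusMeasure d) := by
  obtain ⟨N, hN⟩ := ((tendsto_eLpNorm_partialSymbol hij).eventually_lt_const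
    (show (0 : ℝ≥0∞) < ⊤ by simp)).exists
  have h1 : MemLp (fun ζ => logSymbol i j ζ - partialSymbol i j N ζ) 2 (torusMeasure d) :=
    ⟨((measurable_logSymbol i j).sub
      (continuous_partialSymbol i j N).measurable).aestronglyMeasurable, hN⟩
  obtain ⟨B, hB⟩ := (isCompact_torus d).exists_bound_of_continuousOn
    (continuous_partialSymbol i j N).continuousOn
  have h2 : MemLp (partialSymbol i j N) 2 (torusMeasure d) :=
    MemLp.of_bound (continuous_partialSymbol i j N).aestronglyMeasurable B
      ((ae_mem_torus d).mono hB)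
  convert! h1.add h2 using 1
  ext ζ
  simp

/-- The average over `G` of the logarithmic symbol. -/
noncomputable def averagedLog {d : ℕ} (G : Subgroup (CSpace d ≃ₗ[ℂ] CSpace d)) [Fintype G]
    (i j : Fin d) (z : CSpace d) : ℂ :=
  (Fintype.card G : ℂ)⁻¹ * ∑ σ : G, logSymbol i j ((σ : CSpace d ≃ₗ[ℂ] CSpace d) z)

theorem averagedLog_map {d : ℕ} {G : Subgroup (CSpace d ≃ₗ[ℂ] CSpace d)} [Fintype G]
    (i j : Fin d) (τ : G) (z : CSpace d) :
    averagedLog G i j ((τ : CSpace d ≃ₗ[ℂ] CSpace d) z) = averagedLog G i j z := by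
  unfold averagedLog
  congr 1
  exact Fintype.sum_equiv (Equiv.mulRight τ) _ _ fun σ => rfl

theorem measurable_averagedLog {d : ℕ} (G : Subgroup (CSpace d ≃ₗ[ℂ] CSpace d)) [Fintype G]
    (i j : Fin d) : Measurable (averagedLog G i j) := by
  unfold averagedLog
  refine Measurable.const_mul (Finset.measurable_fun_sum _ fun σ _ => ?_) _
  exact (measurable_logSymbol i j).comp (LinearMap.continuous_of_finiteDimensional
    (σ : CSpace d ≃ₗ[ℂ] CSpace d).toLinearMap).measurable

theorem memLp_averagedLog {d : ℕ} {G : Subgroup (CSpace d ≃ₗ[ℂ] CSpace d)} [Fintype G]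
    (hG : ActsOnPolydisc G) {i j : Fin d} (hij : i ≠ j) :
    MemLp (averagedLog G i j) 2 (torusMeasure d) := by
  refine ⟨(measurable_averagedLog G i j).aestronglyMeasurable, ?_⟩
  have := eLpNorm_average_le hG (c := fun _ => 1) (by simp) (measurable_logSymbol i j)
  simp only [one_mul] at this
  exact this.trans_lt (memLp_logSymbol hij).2

open Classical in
/-- The function on `θ(𝕋^d)` whose lift to the torus is the averaged symbol. -/
noncomputable def quotientSymbol {d : ℕ} (G : Subgroup (CSpace d ≃ₗ[ℂ] CSpace d)) [Fintype G]
    (θ : Fin d → MvPolynomial (Fin d) ℂ) (i j : Fin d) (y : CSpace d) : ℂ :=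
  if h : ∃ ζ ∈ torus d, polyMap θ ζ = y then averagedLog G i j h.choose else 0

theorem enorm_eval_sq_measurable {d : ℕ} (ℓ : MvPolynomial (Fin d) ℂ) :
    Measurable fun ζ : CSpace d => ‖MvPolynomial.eval ζ ℓ‖ₑ ^ 2 :=
  (MvPolynomial.continuous_eval ℓ).measurable.enorm.pow_const 2

theorem eLpNorm_weightedTorusMeasure {d : ℕ} (ℓ : MvPolynomial (Fin d) ℂ) {f : CSpace d → ℂ}
    (hf : Measurable f) : eLpNorm f 2 (weightedTorusMeasure ℓ) =
      eLpNorm (fun ζ => MvPolynomial.eval ζ ℓ * f ζ) 2 (torusMeasure d) := by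
  rw [eLpNorm_eq_lintegral_rpow_enorm_toReal two_ne_zero ENNReal.ofNat_ne_top,
    eLpNorm_eq_lintegral_rpow_enorm_toReal two_ne_zero ENNReal.ofNat_ne_top, weightedTorusMeasure,
    lintegral_withDensity_eq_lintegral_mul _ (enorm_eval_sq_measurable ℓ)
      (hf.enorm.pow_const _)]
  congr 2
  ext ζ
  simp [enorm_mul, mul_pow]

/-- Up to a factor independent of f, the norm on the quotient is that of ℓ·(f ∘ θ) on the torus, so
inequalities descend with the same constant. -/
theorem eLpNorm_quotientMeasure {d : ℕ} {G : Subgroup (CSpace d ≃ₗ[ℂ] CSpace d)}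
    {θ : Fin d → MvPolynomial (Fin d) ℂ} (ℓ : MvPolynomial (Fin d) ℂ) {f : CSpace d → ℂ}
    (hf : Measurable f) : eLpNorm f 2 (quotientMeasure G θ ℓ) =
      (Nat.card G : ℝ≥0∞)⁻¹ ^ (1 / 2 : ℝ≥0∞).toReal *
        eLpNorm (fun ζ => MvPolynomial.eval ζ ℓ * f (polyMap θ ζ)) 2 (torusMeasure d) := by
  rw [quotientMeasure, eLpNorm_smul_measure_of_ne_top ENNReal.ofNat_ne_top, eLpNorm_map_measure
    hf.aestronglyMeasurable (continuous_polyMap θ).aemeasurable,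
    eLpNorm_weightedTorusMeasure ℓ (hf.comp (continuous_polyMap θ).measurable)]
  rfl

theorem memHardyPolydisc_eval {d : ℕ} (p : MvPolynomial (Fin d) ℂ) :
    MemHardyPolydisc fun z => MvPolynomial.eval z p := by
  obtain ⟨B, hB⟩ := (isCompact_closedBall (0 : CSpace d) 1).exists_bound_of_continuousOn
    (MvPolynomial.continuous_eval p).continuousOn
  refine ⟨(differentiable_eval p).differentiableOn, ENNReal.ofReal B ^ 2, by finiteness,
    fun r hr0 hr1 => ?_⟩
  calc _ ≤ ∫⁻ _, ENNReal.ofReal B ^ 2 ∂(torusMeasure d) := by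
        refine lintegral_mono_ae ?_
        filter_upwards [ae_mem_torus d] with ζ hζ
        refine pow_le_pow_left' ?_ 2
        rw [← ofReal_norm]
        refine ENNReal.ofReal_le_ofReal (hB _ ?_)
        have h1 := mem_closedBall_zero_iff.1 (torus_subset_closedBall d hζ)
        rw [mem_closedBall_zero_iff, norm_smul, Complex.norm_real, Real.norm_of_nonneg hr0]
        exact mul_le_one₀ hr1.le (norm_nonneg _) h1
    _ = ENNReal.ofReal B ^ 2 := by simp

section Symbol

variable {d : ℕ} {G : Subgroup (CSpace d ≃ₗ[ℂ] CSpace d)} [Fintype G]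
  {θ : Fin d → MvPolynomial (Fin d) ℂ}

/-- The preimage chosen in `quotientSymbol` is immaterial: fibres of θ in the torus are single
orbits, and the averaged symbol is invariant. -/
theorem quotientSymbol_polyMap (hG : ActsOnPolydisc G) (hθ : IsBasicPolynomialMap G θ)
    (i j : Fin d) {ζ : CSpace d} (hζ : ζ ∈ torus d) :
    quotientSymbol G θ i j (polyMap θ ζ) = averagedLog G i j ζ := by
  have h : ∃ ξ ∈ torus d, polyMap θ ξ = polyMap θ ζ := ⟨ζ, hζ, rfl⟩
  rw [quotientSymbol, dif_pos h]
  obtain ⟨σ, hσ⟩ := hθ.exists_map_eq hG h.choose_spec.1 hζ h.choose_spec.2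
  rw [← averagedLog_map i j σ, hσ]

/-- The choice of preimages need not be measurable. On the compact image of the torus, measurability
of a function is equivalent to measurability of its lift, which is the averaged symbol; elsewhere
the function is 0. -/
theorem measurable_quotientSymbol (hG : ActsOnPolydisc G) (hθ : IsBasicPolynomialMap G θ)
    (i j : Fin d) : Measurable (quotientSymbol G θ i j) := by
  have hc : Continuous fun t : UnitAddTorus (Fin d) => polyMap θ (torusPoint t) :=
    (continuous_polyMap θ).comp continuous_torusPoint
  have hr : IsClosed (Set.range fun t : UnitAddTorus (Fin d) => polyMap θ (torusPoint t)) :=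
    (isCompact_range hc).isClosed
  refine measurable_of_restrict_of_restrict_compl hr.measurableSet ?_ ?_
  · rw [← hc.measurable.measurable_comp_iff_restrict]
    convert! (measurable_averagedLog G i j).comp continuous_torusPoint.measurable using 1
    ext t
    exact quotientSymbol_polyMap hG hθ i j (torusPoint_mem_torus t)
  · convert! measurable_const (a := (0 : ℂ)) using 1
    ext ⟨y, hy⟩
    rw [Set.domRestrict_apply, quotientSymbol, dif_neg]
    rintro ⟨ζ, hζ, rfl⟩
    obtain ⟨t, rfl⟩ := exists_torusPoint_eq hζ
    exact hy ⟨t, rfl⟩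

theorem isAveragedSymbol_quotientSymbol (hG : ActsOnPolydisc G) (hθ : IsBasicPolynomialMap G θ)
    {i j : Fin d} (hij : i ≠ j) : IsAveragedSymbol G θ i j (quotientSymbol G θ i j) := by
  refine tendsto_of_tendsto_of_tendsto_of_le_of_le tendsto_const_nhds
    (tendsto_eLpNorm_partialSymbol hij) (fun _ => zero_le) fun N => ?_
  refine le_of_eq_of_le (eLpNorm_congr_ae ?_) (eLpNorm_average_le hG (c := fun _ => 1) (by simp)
    ((measurable_logSymbol i j).sub (continuous_partialSymbol i j N).measurable))
  filter_upwards [ae_mem_torus d] with ζ hζ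
  rw [quotientSymbol_polyMap hG hθ i j hζ, averagedLog, ← mul_sub, ← Finset.sum_sub_distrib]
  simp

theorem memLp_quotientSymbol (hG : ActsOnPolydisc G) (hθ : IsBasicPolynomialMap G θ)
    {i j : Fin d} (hij : i ≠ j) (ℓ : MvPolynomial (Fin d) ℂ) :
    MemLp (quotientSymbol G θ i j) 2 (quotientMeasure G θ ℓ) := by
  have hm := measurable_quotientSymbol hG hθ i j
  refine ⟨hm.aestronglyMeasurable, ?_⟩
  obtain ⟨B, hB⟩ := exists_bound_on_torus ℓ
  rw [eLpNorm_quotientMeasure ℓ hm]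
  refine ENNReal.mul_lt_top (ENNReal.rpow_lt_top_of_nonneg (by simp)
    (ENNReal.inv_ne_top.2 (by simp))) ?_
  refine (eLpNorm_le_mul_eLpNorm_of_ae_le_mul (c := B) (g := averagedLog G i j) ?_ 2).trans_lt
    (ENNReal.mul_lt_top ENNReal.ofReal_lt_top (memLp_averagedLog hG hij).2)
  filter_upwards [ae_mem_torus d] with ζ hζ
  rw [quotientSymbol_polyMap hG hθ i j hζ, norm_mul]
  exact mul_le_mul_of_nonneg_right (hB ζ hζ) (norm_nonneg _)

theorem coeFn_polyClass (ℓ q : MvPolynomial (Fin d) ℂ) :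
    polyClass G θ ℓ q =ᵐ[quotientMeasure G θ ℓ] fun y => MvPolynomial.eval y q := by
  have h : polyClass G θ ℓ q =ᵐ[quotientMeasure G θ ℓ]
      fun y => (fun _ => (1 : ℂ)) y * MvPolynomial.eval y q :=
    MemLp.coeFn_toLp (memLp_symbol_mul_poly G θ ℓ (memLp_const 1) q)
  exact h.trans (Eventually.of_forall fun y => one_mul _)

theorem polyClass_mem_hardySubspace (ℓ q : MvPolynomial (Fin d) ℂ) :
    polyClass G θ ℓ q ∈ hardySubspace G θ ℓ := by
  refine ⟨fun y => MvPolynomial.eval y q, ⟨(differentiable_eval q).differentiableOn, ?_⟩, ?_⟩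
  · convert! memHardyPolydisc_eval (ℓ * MvPolynomial.aeval θ q) using 2 with z
    rw [map_mul, eval_aeval_polyMap]
  · filter_upwards [ae_comp_polyMap (coeFn_polyClass (G := G) ℓ q)] with ζ hζ
    rw [hζ]
    have hc : Continuous fun r : ℝ => MvPolynomial.eval (polyMap θ ((r : ℂ) • ζ)) q :=
      (MvPolynomial.continuous_eval q).comp ((continuous_polyMap θ).comp (by fun_prop))
    have := (hc.tendsto 1).mono_left (nhdsWithin_le_nhds (s := Set.Iio 1))
    simpa using this

/-- Projection onto the orthogonal complement kills polynomials, so the Hankel norm is at most the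
distance to any of them. Since an orthogonal complement is always closed, closedness of the Hardy
space plays no role here. -/
theorem norm_bigHankel_le (ℓ : MvPolynomial (Fin d) ℂ) {φ : CSpace d → ℂ}
    (hφ : MemLp φ 2 (quotientMeasure G θ ℓ)) (q q' : MvPolynomial (Fin d) ℂ) :
    ‖bigHankel G θ ℓ hφ q‖ ≤ ‖symbolMul G θ ℓ hφ q - polyClass G θ ℓ q'‖ := by
  have h0 : (hardySubspace G θ ℓ)ᗮ.orthogonalProjectionOnto (polyClass G θ ℓ q') = 0 := by
    rw [Submodule.orthogonalProjectionOnto_eq_zero_iff]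
    exact Submodule.le_orthogonal_orthogonal _ (polyClass_mem_hardySubspace ℓ q')
  have h1 := Submodule.norm_orthogonalProjectionOnto_apply_le (hardySubspace G θ ℓ)ᗮ
    (symbolMul G θ ℓ hφ q - polyClass G θ ℓ q')
  rwa [map_sub, h0, sub_zero] at h1

theorem norm_character_eq_one (ρ : G →* ℂˣ) (σ : G) : ‖((ρ σ : ℂˣ) : ℂ)‖ = 1 := by
  have h : ((ρ σ : ℂˣ) : ℂ) ^ Fintype.card G = 1 := by
    rw [← Units.val_pow_eq_pow_val, ← map_pow, pow_card_eq_one, map_one, Units.val_one]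
  have h2 : ‖((ρ σ : ℂˣ) : ℂ)‖ ^ Fintype.card G = 1 := by rw [← norm_pow, h, norm_one]
  exact (pow_eq_one_iff_of_nonneg (norm_nonneg _) Fintype.card_ne_zero).1 h2

/-- With Q = ℓ·(q ∘ θ) relatively invariant, the ρ⁻¹-twisted average of φQ is (Φ ∘ θ)Q, and that of
R is a relative invariant S. By the defining property of ℓ, S = ℓ·(q' ∘ θ), so ℓ cancels into the
weight of the quotient measure. -/
theorem exists_polynomial_approximant (hG : ActsOnPolydisc G) (hθ : IsBasicPolynomialMap G θ)
    {i j : Fin d} (hij : i ≠ j) {ρ : G →* ℂˣ} {ℓ : MvPolynomial (Fin d) ℂ}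
    (hℓ : IsRelInvariantGenerator ρ ℓ) (q : MvPolynomial (Fin d) ℂ) :
    ∃ q' : MvPolynomial (Fin d) ℂ,
      eLpNorm (fun y => quotientSymbol G θ i j y * MvPolynomial.eval y q - MvPolynomial.eval y q') 2
        (quotientMeasure G θ ℓ) ≤ ENNReal.ofReal (2 * Real.pi) *
        eLpNorm (fun y => MvPolynomial.eval y q) 2 (quotientMeasure G θ ℓ) := by
  set Q : MvPolynomial (Fin d) ℂ := ℓ * MvPolynomial.aeval θ q with hQdef
  have hQe : ∀ z, MvPolynomial.eval z Q =
      MvPolynomial.eval z ℓ * MvPolynomial.eval (polyMap θ z) q := fun z => by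
    rw [hQdef, map_mul, eval_aeval_polyMap]
  have hQ : IsRelInvariant ρ Q := fun σ z => by
    rw [hQe, hQe, hθ.polyMap_map, hℓ.2.2.1 σ z, mul_assoc]
  obtain ⟨R, hR⟩ := exists_polynomial_eLpNorm_sub_le hij Q
  obtain ⟨S, hS, hSe⟩ := exists_relInvariant_average ρ
    (MvPolynomial.C (Fintype.card G : ℂ)⁻¹ * R)
  obtain ⟨h, hh, hSh⟩ := hℓ.2.2.2 S hS
  obtain ⟨q', hq'⟩ := hθ.exists_eval_eq hh
  refine ⟨q', ?_⟩
  have hmq := (MvPolynomial.continuous_eval q).measurable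
  have hmu : Measurable fun ζ : CSpace d =>
      logSymbol i j ζ * MvPolynomial.eval ζ Q - MvPolynomial.eval ζ R :=
    ((measurable_logSymbol i j).mul (MvPolynomial.continuous_eval Q).measurable).sub
      (MvPolynomial.continuous_eval R).measurable
  have hmv : Measurable fun y : CSpace d =>
      quotientSymbol G θ i j y * MvPolynomial.eval y q - MvPolynomial.eval y q' :=
    ((measurable_quotientSymbol hG hθ i j).mul hmq).sub
      (MvPolynomial.continuous_eval q').measurable
  rw [eLpNorm_quotientMeasure ℓ hmv, eLpNorm_quotientMeasure ℓ hmq, mul_left_comm]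
  refine mul_le_mul_right ?_ _
  simp only [← hQe]
  refine le_trans (le_of_eq_of_le (eLpNorm_congr_ae ?_) (eLpNorm_average_le hG
    (c := fun σ => (((ρ σ)⁻¹ : ℂˣ) : ℂ))
    (fun σ => by rw [← map_inv]; exact norm_character_eq_one ρ σ⁻¹) hmu)) hR
  filter_upwards [ae_mem_torus d] with ζ hζ
  have h1 : MvPolynomial.eval ζ ℓ * MvPolynomial.eval (polyMap θ ζ) q' =
      MvPolynomial.eval ζ S := by rw [← hq', hSh, map_mul]
  rw [mul_sub, h1, hSe, quotientSymbol_polyMap hG hθ i j hζ, mul_left_comm, ← hQe, averagedLog,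
    mul_assoc, Finset.sum_mul, Finset.mul_sum, Finset.mul_sum, ← Finset.sum_sub_distrib]
  refine Finset.sum_congr rfl fun σ _ => ?_
  rw [hQ σ ζ, map_mul (MvPolynomial.eval _) (MvPolynomial.C _), MvPolynomial.eval_C,
    Units.val_inv_eq_inv_val]
  have h0 : ((ρ σ : ℂˣ) : ℂ) ≠ 0 := Units.ne_zero _
  field_simp

theorem isBoundedBigHankel_quotientSymbol (hG : ActsOnPolydisc G) (hθ : IsBasicPolynomialMap G θ)
    {i j : Fin d} (hij : i ≠ j) {ρ : G →* ℂˣ} {ℓ : MvPolynomial (Fin d) ℂ}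
    (hℓ : IsRelInvariantGenerator ρ ℓ) :
    IsBoundedBigHankel G θ ℓ (memLp_quotientSymbol hG hθ hij ℓ) := by
  refine ⟨2 * Real.pi, fun q => ?_⟩
  obtain ⟨q', hq'⟩ := exists_polynomial_approximant hG hθ hij hℓ q
  refine (norm_bigHankel_le ℓ _ q q').trans ?_
  have h1 : (fun y => quotientSymbol G θ i j y * MvPolynomial.eval y q -
      MvPolynomial.eval y q') =ᵐ[quotientMeasure G θ ℓ]
      (symbolMul G θ ℓ (memLp_quotientSymbol hG hθ hij ℓ) q - polyClass G θ ℓ q' :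
        Lp ℂ 2 (quotientMeasure G θ ℓ)) := by
    have ha : symbolMul G θ ℓ (memLp_quotientSymbol hG hθ hij ℓ) q =ᵐ[quotientMeasure G θ ℓ]
      fun y => quotientSymbol G θ i j y * MvPolynomial.eval y q := MemLp.coeFn_toLp _
    filter_upwards [Lp.coeFn_sub (symbolMul G θ ℓ (memLp_quotientSymbol hG hθ hij ℓ) q)
      (polyClass G θ ℓ q'), ha, coeFn_polyClass ℓ q'] with y h ha hb
    rw [h, Pi.sub_apply, ha, hb]
  have h2 : (fun y => MvPolynomial.eval y q) =ᵐ[quotientMeasure G θ ℓ] polyClass G θ ℓ q :=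
    (coeFn_polyClass ℓ q).symm
  rw [eLpNorm_congr_ae h1, eLpNorm_congr_ae h2] at hq'
  rw [Lp.norm_def, Lp.norm_def, ← ENNReal.toReal_ofReal (show 0 ≤ 2 * Real.pi by positivity),
    ← ENNReal.toReal_mul]
  exact ENNReal.toReal_mono (ENNReal.mul_ne_top ENNReal.ofReal_ne_top (Lp.eLpNorm_ne_top _)) hq'

end Symbol

/-! ### Mean values over rotation-invariant sets. -/

/-- On a finite measure space, integrals converge along `L²`-bounded sequences that converge
almost everywhere. -/
theorem tendsto_integral_of_lintegral_sq_le {α : Type*} [MeasurableSpace α] {μ : Measure α}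
    [IsFiniteMeasure μ] {f : ℕ → α → ℂ} {g : α → ℂ} (hf : ∀ n, AEStronglyMeasurable (f n) μ)
    {C : ℝ≥0∞} (hC : C < ⊤) (hfC : ∀ n, ∫⁻ x, ‖f n x‖ₑ ^ 2 ∂μ ≤ C)
    (hfg : ∀ᵐ x ∂μ, Tendsto (fun n => f n x) atTop (𝓝 (g x))) :
    Integrable g μ ∧ Tendsto (fun n => ∫ x, f n x ∂μ) atTop (𝓝 (∫ x, g x ∂μ)) := by
  have hL2 : ∀ n, eLpNorm (f n) 2 μ ≤ C ^ (1 / 2 : ℝ) := by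
    intro n
    rw [eLpNorm_eq_lintegral_rpow_enorm_toReal two_ne_zero ENNReal.ofNat_ne_top]
    simp only [ENNReal.toReal_ofNat, ENNReal.rpow_ofNat]
    exact ENNReal.rpow_le_rpow (hfC n) (by norm_num)
  have hCt : C ^ (1 / 2 : ℝ) < ⊤ := ENNReal.rpow_lt_top_of_nonneg (by norm_num) hC.ne
  have hf2 : ∀ n, MemLp (f n) 2 μ := fun n => ⟨hf n, (hL2 n).trans_lt hCt⟩
  have hgm : AEStronglyMeasurable g μ := aestronglyMeasurable_of_tendsto_ae atTop hf hfg
  have hg2 : MemLp g 2 μ := by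
    refine ⟨hgm, ((Lp.eLpNorm_lim_le_liminf_eLpNorm hf g hfg).trans ?_).trans_lt hCt⟩
    exact liminf_le_of_le (by isBoundedDefault) fun b hb => by
      obtain ⟨n, hn⟩ := hb.exists
      exact hn.trans (hL2 n)
  have hg1 : MemLp g 1 μ := hg2.mono_exponent (by norm_num)
  have hf1 : ∀ n, MemLp (f n) 1 μ := fun n => (hf2 n).mono_exponent (by norm_num)
  -- There is no dominating function, but the L² bound gives uniform integrability: where |f_n| ≥ K
  -- one has |f_n| ≤ |f_n|²/K, so the tails are at most C/K, and K = C/ε + 1 makes this at most ε.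
  have hui : UnifIntegrable f 1 μ := by
    refine unifIntegrable_of le_rfl ENNReal.one_ne_top hf fun ε hε => ?_
    set K : NNReal := C.toNNReal / ε.toNNReal + 1 with hK
    have hK0 : (K : ℝ≥0∞) ≠ 0 := by
      rw [ENNReal.coe_ne_zero]
      positivity
    refine ⟨K, fun n => ?_⟩
    rw [eLpNorm_one_eq_lintegral_enorm]
    have hle : ∀ x, ‖({x | K ≤ ‖f n x‖₊}.indicator (f n)) x‖ₑ ≤ (K : ℝ≥0∞)⁻¹ * ‖f n x‖ₑ ^ 2 := by
      intro x
      by_cases hx : K ≤ ‖f n x‖₊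
      · rw [Set.indicator_of_mem (by exact hx), sq, ← mul_assoc]
        have h1 : (K : ℝ≥0∞) ≤ ‖f n x‖ₑ := by
          rw [enorm_eq_nnnorm]
          exact_mod_cast hx
        have h2 : 1 ≤ (K : ℝ≥0∞)⁻¹ * ‖f n x‖ₑ := by
          rw [← ENNReal.inv_mul_cancel hK0 ENNReal.coe_ne_top]
          gcongr
        calc ‖f n x‖ₑ = 1 * ‖f n x‖ₑ := (one_mul _).symm
          _ ≤ _ := by gcongr
      · rw [Set.indicator_of_notMem (by exact hx)]
        simp
    calc _ ≤ ∫⁻ x, (K : ℝ≥0∞)⁻¹ * ‖f n x‖ₑ ^ 2 ∂μ := lintegral_mono hle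
      _ = (K : ℝ≥0∞)⁻¹ * ∫⁻ x, ‖f n x‖ₑ ^ 2 ∂μ :=
        lintegral_const_mul' _ _ (ENNReal.inv_ne_top.2 hK0)
      _ ≤ (K : ℝ≥0∞)⁻¹ * C := by
        gcongr
        exact hfC n
      _ ≤ ENNReal.ofReal ε := by
        rw [mul_comm, ← div_eq_mul_inv]
        refine ENNReal.div_le_of_le_mul ?_
        rw [← ENNReal.coe_toNNReal hC.ne, ENNReal.ofReal, ← ENNReal.coe_mul, ENNReal.coe_le_coe,
          hK, mul_add, mul_one]
        have he : ε.toNNReal ≠ 0 := (Real.toNNReal_pos.2 hε).ne'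
        rw [mul_div_cancel₀ _ he]
        exact le_self_add
  have hL1 := tendsto_Lp_finite_of_tendsto_ae le_rfl ENNReal.one_ne_top hf hg1 hui hfg
  exact ⟨memLp_one_iff_integrable.1 hg1, tendsto_integral_of_L1' g hgm
    (Eventually.of_forall fun n => memLp_one_iff_integrable.1 (hf1 n)) hL1⟩

theorem measurePreserving_smul_torusMeasure {d : ℕ} {c : ℂ} (hc : ‖c‖ = 1) :
    MeasurePreserving (fun ζ : CSpace d => c • ζ) (torusMeasure d) (torusMeasure d) := by
  have hc0 : c ≠ 0 := by
    rintro rfl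
    simp at hc
  exact measurePreserving_of_norm_map (LinearEquiv.smulOfNeZero ℂ (CSpace d) c hc0)
    fun z => by
      change ‖c • z‖ = _
      rw [norm_smul, hc, one_mul]

theorem smul_mem_polydisc {d : ℕ} {c : ℂ} (hc : ‖c‖ < 1) {z : CSpace d}
    (hz : z ∈ Metric.closedBall (0 : CSpace d) 1) : c • z ∈ polydisc d := by
  rw [polydisc_eq_ball, mem_ball_zero_iff, norm_smul]
  rw [mem_closedBall_zero_iff] at hz
  exact (mul_le_of_le_one_right (norm_nonneg _) hz).trans_lt hc

/-- The mean value property against rotation invariant weights on the torus. -/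
theorem integral_mul_smul_eq {d : ℕ} {g w : CSpace d → ℂ} (hg : Measurable g)
    (hgd : DifferentiableOn ℂ g (polydisc d)) (hw : Measurable w) {B : ℝ}
    (hB : ∀ ζ ∈ torus d, ‖w ζ‖ ≤ B) (hrot : ∀ (c : ℂ) (ζ : CSpace d), ‖c‖ = 1 → w (c • ζ) = w ζ)
    {r : ℝ} (hr0 : 0 ≤ r) (hr1 : r < 1) :
    ∫ ζ, w ζ * g ((r : ℂ) • ζ) ∂(torusMeasure d) = (∫ ζ, w ζ ∂(torusMeasure d)) * g 0 := by
  have hnorm : ∀ x : ℝ, ‖circleMap 0 r x‖ = r := fun x => by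
    rw [norm_circleMap_zero, abs_of_nonneg hr0]
  -- Measure and weight are invariant under rotation, so replacing r by r e^{ix} changes nothing.
  -- Integrating over x and exchanging the integrals leaves the one-variable mean value property on
  -- the slices c ↦ g(cζ).
  have hslice : ∀ x : ℝ, ∫ ζ, w ζ * g (circleMap 0 r x • ζ) ∂(torusMeasure d) =
      ∫ ζ, w ζ * g ((r : ℂ) • ζ) ∂(torusMeasure d) := by
    intro x
    set c := Complex.exp (x * Complex.I) with hcdef
    have hc : ‖c‖ = 1 := Complex.norm_exp_ofReal_mul_I x
    have hc0 : c ≠ 0 := Complex.exp_ne_zero _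
    refine Eq.trans ?_ ((measurePreserving_smul_torusMeasure hc).integral_comp
      (Homeomorph.smulOfNeZero c hc0).measurableEmbedding fun ζ => w ζ * g ((r : ℂ) • ζ))
    congr 1
    ext ζ
    rw [hrot c ζ hc, smul_smul, circleMap_zero]
  obtain ⟨D, hD⟩ := (isCompact_closedBall (0 : CSpace d) r).exists_bound_of_continuousOn
    (f := g) (hgd.continuousOn.mono (by
      rw [polydisc_eq_ball]
      exact Metric.closedBall_subset_ball hr1))
  have hmem : ∀ (x : ℝ) (ζ : CSpace d), ζ ∈ torus d → ‖g (circleMap 0 r x • ζ)‖ ≤ D := by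
    intro x ζ hζ
    refine hD _ ?_
    rw [mem_closedBall_zero_iff, norm_smul, hnorm]
    exact mul_le_of_le_one_right hr0 (mem_closedBall_zero_iff.1 (torus_subset_closedBall d hζ))
  have hmeas : Measurable (Function.uncurry fun (x : ℝ) (ζ : CSpace d) =>
      w ζ * g (circleMap 0 r x • ζ)) := by
    refine (hw.comp measurable_snd).mul (hg.comp ?_)
    have : Continuous fun p : ℝ × CSpace d => circleMap 0 r p.1 • p.2 :=
      ((continuous_circleMap 0 r).comp continuous_fst).smul continuous_snd
    exact this.measurable
  have hint : Integrable (Function.uncurry fun (x : ℝ) (ζ : CSpace d) =>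
      w ζ * g (circleMap 0 r x • ζ))
      ((volume.restrict (Set.Ioc 0 (2 * Real.pi))).prod (torusMeasure d)) := by
    refine Integrable.of_bound hmeas.aestronglyMeasurable (B * D) ?_
    have hae : ∀ᵐ p ∂((volume.restrict (Set.Ioc 0 (2 * Real.pi))).prod (torusMeasure d)),
        p.2 ∈ torus d := Measure.quasiMeasurePreserving_snd.ae (ae_mem_torus d)
    filter_upwards [hae] with p hp
    rw [Function.uncurry_def, norm_mul]
    exact mul_le_mul (hB _ hp) (hmem _ _ hp) (norm_nonneg _) ((norm_nonneg _).trans (hB _ hp))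
  have hswap := integral_integral_swap hint
  simp only [hslice, integral_const_mul] at hswap
  have hmv : ∀ ζ ∈ torus d, ∫ x in Set.Ioc 0 (2 * Real.pi), g (circleMap 0 r x • ζ) =
      (2 * Real.pi : ℝ) * g 0 := by
    intro ζ hζ
    have hζ1 := torus_subset_closedBall d hζ
    have hmaps : ∀ c ∈ Metric.ball (0 : ℂ) 1, c • ζ ∈ polydisc d := fun c hc =>
      smul_mem_polydisc (mem_ball_zero_iff.1 hc) hζ1
    have hd1 : DifferentiableOn ℂ (fun c : ℂ => g (c • ζ)) (Metric.ball 0 1) :=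
      hgd.comp (by fun_prop) hmaps
    have hdc : DiffContOnCl ℂ (fun c : ℂ => g (c • ζ)) (Metric.ball 0 |r|) := by
      refine DifferentiableOn.diffContOnCl (hd1.mono (Metric.closure_ball_subset_closedBall.trans ?_))
      rw [abs_of_nonneg hr0]
      exact Metric.closedBall_subset_ball hr1
    have havg := hdc.circleAverage
    rw [Real.circleAverage_def, zero_smul,
      intervalIntegral.integral_of_le Real.two_pi_pos.le] at havg
    rw [← havg, Complex.real_smul, ← mul_assoc, ← Complex.ofReal_mul,
      mul_inv_cancel₀ Real.two_pi_pos.ne', Complex.ofReal_one, one_mul]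
  have hrhs : ∫ ζ, w ζ * (∫ x in Set.Ioc 0 (2 * Real.pi), g (circleMap 0 r x • ζ))
      ∂(torusMeasure d) = ∫ ζ, w ζ * ((2 * Real.pi : ℝ) * g 0) ∂(torusMeasure d) := by
    refine integral_congr_ae ?_
    filter_upwards [ae_mem_torus d] with ζ hζ
    rw [hmv ζ hζ]
  rw [hrhs, integral_mul_const, integral_const, Complex.real_smul, measureReal_restrict_apply_univ,
    Real.volume_real_Ioc_of_le Real.two_pi_pos.le, sub_zero, mul_left_comm] at hswap
  exact mul_left_cancel₀ (Complex.ofReal_ne_zero.2 Real.two_pi_pos.ne') hswap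

theorem eval_smul_of_isHomogeneous {d n : ℕ} {p : MvPolynomial (Fin d) ℂ} (hp : p.IsHomogeneous n)
    (c : ℂ) (z : CSpace d) : MvPolynomial.eval (c • z) p = c ^ n * MvPolynomial.eval z p := by
  rw [MvPolynomial.eval_eq', MvPolynomial.eval_eq', Finset.mul_sum]
  refine Finset.sum_congr rfl fun α hα => ?_
  have hdeg : ∑ l, α l = n := by
    rw [← hp (MvPolynomial.mem_support_iff.1 hα), Finsupp.weight_apply, Finsupp.sum_fintype] <;>
      simp
  simp only [Pi.smul_apply, smul_eq_mul, mul_pow, Finset.prod_mul_distrib, Finset.prod_pow_eq_pow_sum,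
    hdeg]
  ring

/-! ### Neighbourhoods of the singular set of the symbol. -/

/-- The points at which `z_i conj(z_j)` is close to but different from `1`. -/
def nearDiagonal {d : ℕ} (i j : Fin d) (ε : ℝ) : Set (CSpace d) :=
  {z | 0 < ‖1 - z i * conj (z j)‖ ∧ ‖1 - z i * conj (z j)‖ < ε}

theorem isOpen_nearDiagonal {d : ℕ} (i j : Fin d) (ε : ℝ) : IsOpen (nearDiagonal i j ε) := by
  have hc : Continuous fun z : CSpace d => ‖1 - z i * conj (z j)‖ := by fun_prop
  exact (isOpen_lt continuous_const hc).inter (isOpen_lt hc continuous_const)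

theorem smul_mem_nearDiagonal_iff {d : ℕ} (i j : Fin d) (ε : ℝ) {c : ℂ} (hc : ‖c‖ = 1)
    (z : CSpace d) : c • z ∈ nearDiagonal i j ε ↔ z ∈ nearDiagonal i j ε := by
  have h : (c • z) i * conj ((c • z) j) = z i * conj (z j) := by
    simp only [Pi.smul_apply, smul_eq_mul, map_mul]
    have : c * conj c = 1 := by
      rw [Complex.mul_conj, Complex.normSq_eq_norm_sq, hc]
      simp
    linear_combination (z i * conj (z j)) * this
  simp only [nearDiagonal, Set.mem_ofPred_eq, h]

/-- A polynomial vanishing on a product of infinite sets is zero; the set contains a product of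
arcs. -/
theorem exists_mem_nearDiagonal_eval_ne_zero {d : ℕ} {i j : Fin d} (hij : i ≠ j) {ε : ℝ}
    (hε : 0 < ε) {p : MvPolynomial (Fin d) ℂ} (hp : p ≠ 0) :
    ∃ ζ ∈ torus d, ζ ∈ nearDiagonal i j ε ∧ MvPolynomial.eval ζ p ≠ 0 := by
  by_contra! hcon
  refine hp ?_
  -- The angle of z_j is taken in (-δ, 0) and the others in (0, δ), so x_i - x_j lies in (0, 2δ).
  -- The bound δ ≤ 1 keeps these angles below π, where the argument recovers them, and δ ≤ ε/2 keeps
  -- the chord below ε.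
  set δ : ℝ := min 1 (ε / 2) with hδ
  have hδ0 : 0 < δ := lt_min one_pos (half_pos hε)
  have hδ1 : δ ≤ 1 := min_le_left _ _
  have hδε : 2 * δ ≤ ε := by
    have := min_le_right 1 (ε / 2)
    linarith
  have hpi := Real.pi_gt_three
  let I : Fin d → Set ℝ := fun l => if l = j then Set.Ioo (-δ) 0 else Set.Ioo 0 δ
  have hI : ∀ l, ∀ x ∈ I l, -δ < x ∧ x < δ := by
    intro l x hx
    simp only [I] at hx
    split_ifs at hx
    · exact ⟨hx.1, hx.2.trans hδ0⟩
    · exact ⟨by linarith [hx.1], hx.2⟩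
  refine MvPolynomial.funext_set (fun l => (fun x : ℝ => (Circle.exp x : ℂ)) '' I l)
    (fun l => Set.Infinite.image ?_ ?_) fun ζ hζ => ?_
  · intro x hx y hy hxy
    have hx' := hI l x hx
    have hy' := hI l y hy
    rw [← Circle.arg_exp (x := x) (by linarith) (by linarith),
      ← Circle.arg_exp (x := y) (by linarith) (by linarith)]
    exact congrArg Complex.arg hxy
  · simp only [I]
    split_ifs
    · exact Set.Ioo_infinite (by linarith)
    · exact Set.Ioo_infinite hδ0
  · rw [map_zero]
    choose x hx hxζ using fun l => hζ l (Set.mem_univ l)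
    refine hcon ζ (fun l => by rw [← hxζ l]; exact Circle.norm_coe _) ?_
    have hxi : x i ∈ Set.Ioo 0 δ := by
      have := hx i
      simpa only [I, if_neg hij] using this
    have hxj : x j ∈ Set.Ioo (-δ) 0 := by
      have := hx j
      simpa only [I, if_true] using this
    have hw : ζ i * conj (ζ j) = Circle.exp (x i - x j) := by
      rw [← hxζ i, ← hxζ j, Circle.exp_sub, div_eq_mul_inv, Circle.coe_mul,
        Circle.coe_inv_eq_conj]
    have h0 : 0 < x i - x j := by linarith [hxi.1, hxj.2]
    have h2 : x i - x j < 2 * δ := by linarith [hxi.2, hxj.1]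
    rw [nearDiagonal, Set.mem_ofPred_eq, hw]
    constructor
    · rw [norm_pos_iff, sub_ne_zero]
      intro h1
      have := Circle.arg_exp (x := x i - x j) (by linarith) (by linarith)
      rw [← h1, Complex.arg_one] at this
      exact h0.ne this
    · rw [norm_sub_rev, Circle.coe_exp, mul_comm]
      refine Real.norm_exp_I_mul_ofReal_sub_one_le.trans_lt ?_
      rw [Real.norm_of_nonneg h0.le]
      linarith

theorem weightedTorusMeasure_nearDiagonal_ne_zero {d : ℕ} {i j : Fin d} (hij : i ≠ j) {ε : ℝ}
    (hε : 0 < ε) {ℓ : MvPolynomial (Fin d) ℂ} (hℓ : ℓ ≠ 0) :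
    weightedTorusMeasure ℓ (nearDiagonal i j ε) ≠ 0 := by
  rw [weightedTorusMeasure, Ne, withDensity_apply_eq_zero (enorm_eval_sq_measurable ℓ)]
  have hopen : IsOpen ({ζ : CSpace d | ‖MvPolynomial.eval ζ ℓ‖ₑ ^ 2 ≠ 0} ∩
      nearDiagonal i j ε) := by
    refine IsOpen.inter ?_ (isOpen_nearDiagonal i j ε)
    simp only [ne_eq, pow_eq_zero_iff, OfNat.ofNat_ne_zero, not_false_eq_true, enorm_eq_zero]
    exact isOpen_ne_fun (MvPolynomial.continuous_eval ℓ) continuous_const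
  rw [torusMeasure, Measure.map_apply continuous_torusPoint.measurable hopen.measurableSet]
  refine (IsOpen.measure_pos _ (hopen.preimage continuous_torusPoint) ?_).ne'
  obtain ⟨ζ, hζ, hE, hne⟩ := exists_mem_nearDiagonal_eval_ne_zero hij hε hℓ
  obtain ⟨t, rfl⟩ := exists_torusPoint_eq hζ
  exact ⟨t, by simpa using hne, hE⟩

/-- As |1 - z_i conj z_j| ≤ 2, every term of the average has real part at least -log 2. So the large
term σ = 1 cannot be cancelled, and the exponent |G|(K + log 2) pays for the other terms and for the
division by |G|. -/
theorem le_re_averagedLog {d : ℕ} {G : Subgroup (CSpace d ≃ₗ[ℂ] CSpace d)} [Fintype G]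
    (hG : ActsOnPolydisc G) (i j : Fin d) (K : ℝ) {ζ : CSpace d} (hζ : ζ ∈ torus d)
    (hE : ζ ∈ nearDiagonal i j (Real.exp (-(Fintype.card G * (K + Real.log 2))))) :
    K ≤ (averagedLog G i j ζ).re := by
  have hre : ∀ z : CSpace d, (logSymbol i j z).re = -Real.log ‖1 - z i * conj (z j)‖ := fun z => by
    rw [logSymbol, Complex.neg_re, Complex.log_re]
  have hcard : (0 : ℝ) < Fintype.card G := by exact_mod_cast Fintype.card_pos
  have hge : ∀ σ : G, 0 ≤ (logSymbol i j ((σ : CSpace d ≃ₗ[ℂ] CSpace d) ζ)).re + Real.log 2 := by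
    intro σ
    set z := (σ : CSpace d ≃ₗ[ℂ] CSpace d) ζ
    have hz : ‖z‖ ≤ 1 := by
      rw [hG.norm_map σ.2]
      exact mem_closedBall_zero_iff.1 (torus_subset_closedBall d hζ)
    rw [hre]
    have h2 : ‖1 - z i * conj (z j)‖ ≤ 2 := by
      refine (norm_sub_le _ _).trans ?_
      rw [norm_one, norm_mul, RCLike.norm_conj]
      have := mul_le_one₀ ((norm_le_pi_norm z i).trans hz) (norm_nonneg _)
        ((norm_le_pi_norm z j).trans hz)
      linarith
    rcases (norm_nonneg (1 - z i * conj (z j))).eq_or_lt with h0 | h0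
    · rw [← h0, Real.log_zero]
      linarith [Real.log_pos one_lt_two]
    · linarith [Real.log_le_log h0 h2]
  -- Points with z_i conj z_j = 1 must be excluded here, since the logarithm takes the value 0 at 0.
  have hone : Fintype.card G * (K + Real.log 2) ≤ (logSymbol i j ζ).re := by
    rw [hre]
    have := (Real.log_le_log hE.1 hE.2.le)
    rw [Real.log_exp] at this
    linarith
  have hsum : Fintype.card G * (K + Real.log 2) ≤
      ∑ σ : G, ((logSymbol i j ((σ : CSpace d ≃ₗ[ℂ] CSpace d) ζ)).re + Real.log 2) := by
    refine le_trans ?_ (Finset.single_le_sum (fun σ _ => hge σ) (Finset.mem_univ (1 : G)))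
    have h1 : ((1 : G) : CSpace d ≃ₗ[ℂ] CSpace d) ζ = ζ := rfl
    rw [h1]
    linarith [Real.log_pos one_lt_two]
  rw [Finset.sum_add_distrib, Finset.sum_const, Finset.card_univ, nsmul_eq_mul, mul_add] at hsum
  have hA : (averagedLog G i j ζ).re = (Fintype.card G : ℝ)⁻¹ *
      ∑ σ : G, (logSymbol i j ((σ : CSpace d ≃ₗ[ℂ] CSpace d) ζ)).re := by
    rw [averagedLog, ← Complex.ofReal_natCast, ← Complex.ofReal_inv, Complex.re_ofReal_mul,
      Complex.re_sum]
  rw [hA, le_inv_mul_iff₀ hcard]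
  linarith

theorem ae_mem_torus_weighted {d : ℕ} (ℓ : MvPolynomial (Fin d) ℂ) :
    ∀ᵐ ζ ∂(weightedTorusMeasure ℓ), ζ ∈ torus d :=
  (withDensity_absolutelyContinuous _ _).ae_le (ae_mem_torus d)

instance isFiniteMeasure_weightedTorusMeasure {d : ℕ} (ℓ : MvPolynomial (Fin d) ℂ) :
    IsFiniteMeasure (weightedTorusMeasure ℓ) := by
  obtain ⟨B, hB⟩ := exists_bound_on_torus ℓ
  refine isFiniteMeasure_withDensity (ne_of_lt ?_)
  calc _ ≤ ∫⁻ _, ENNReal.ofReal B ^ 2 ∂(torusMeasure d) := by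
        refine lintegral_mono_ae ?_
        filter_upwards [ae_mem_torus d] with ζ hζ
        refine pow_le_pow_left' ?_ 2
        rw [← ofReal_norm]
        exact ENNReal.ofReal_le_ofReal (hB ζ hζ)
    _ < ⊤ := by
        rw [lintegral_const, measure_univ, mul_one]
        finiteness

/-- The mean value property over the sets `nearDiagonal i j ε`. -/
theorem setIntegral_nearDiagonal {d : ℕ} (i j : Fin d) (ε : ℝ) {n : ℕ}
    {ℓ : MvPolynomial (Fin d) ℂ} (hℓ : ℓ.IsHomogeneous n) {g : CSpace d → ℂ} (hg : Measurable g)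
    (hgd : DifferentiableOn ℂ g (polydisc d)) {r : ℝ} (hr0 : 0 ≤ r) (hr1 : r < 1) :
    ∫ ζ in nearDiagonal i j ε, g ((r : ℂ) • ζ) ∂(weightedTorusMeasure ℓ) =
      (weightedTorusMeasure ℓ).real (nearDiagonal i j ε) * g 0 := by
  have hE := (isOpen_nearDiagonal i j ε).measurableSet
  -- This weight is rotation invariant: |ℓ| by homogeneity, the set because it depends only on z_i
  -- conj z_j.
  set w : CSpace d → ℂ := (nearDiagonal i j ε).indicator
    (fun ζ => ((‖MvPolynomial.eval ζ ℓ‖ ^ 2 : ℝ) : ℂ)) with hwdef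
  have hw : Measurable w := by
    refine Measurable.indicator ?_ hE
    have : Continuous fun ζ : CSpace d => ((‖MvPolynomial.eval ζ ℓ‖ ^ 2 : ℝ) : ℂ) :=
      Complex.continuous_ofReal.comp ((MvPolynomial.continuous_eval ℓ).norm.pow 2)
    exact this.measurable
  obtain ⟨B, hB⟩ := exists_bound_on_torus ℓ
  have hwB : ∀ ζ ∈ torus d, ‖w ζ‖ ≤ B ^ 2 := by
    intro ζ hζ
    refine (norm_indicator_le_norm_self _ _).trans ?_
    rw [Complex.norm_real, norm_pow, norm_norm]
    exact pow_le_pow_left₀ (norm_nonneg _) (hB ζ hζ) 2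
  have hrot : ∀ (c : ℂ) (ζ : CSpace d), ‖c‖ = 1 → w (c • ζ) = w ζ := by
    intro c ζ hc
    have hiff := smul_mem_nearDiagonal_iff i j ε hc ζ
    by_cases hζ : ζ ∈ nearDiagonal i j ε
    · rw [hwdef, Set.indicator_of_mem (hiff.2 hζ), Set.indicator_of_mem hζ,
        eval_smul_of_isHomogeneous hℓ, norm_mul, norm_pow, hc, one_pow, one_mul]
    · rw [hwdef, Set.indicator_of_notMem (hiff.not.2 hζ), Set.indicator_of_notMem hζ]
  have hint : ∀ f : CSpace d → ℂ, ∫ ζ in nearDiagonal i j ε, f ζ ∂(weightedTorusMeasure ℓ) =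
      ∫ ζ, w ζ * f ζ ∂(torusMeasure d) := by
    intro f
    rw [← integral_indicator hE, weightedTorusMeasure,
      integral_withDensity_eq_integral_toReal_smul (enorm_eval_sq_measurable ℓ)
        (Eventually.of_forall fun ζ => by finiteness)]
    congr 1
    ext ζ
    by_cases hζ : ζ ∈ nearDiagonal i j ε
    · simp [hwdef, hζ, Complex.real_smul]
    · simp [hwdef, hζ]
  have hone := hint fun _ => 1
  simp only [mul_one] at hone
  rw [setIntegral_const, Complex.real_smul, mul_one] at hone
  rw [hint, integral_mul_smul_eq hg hgd hw hwB hrot hr0 hr1, hone]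

/-- The Hardy norm involves ℓ(rζ), the weighted measure ℓ(ζ). By homogeneity they differ by r^n, and
r ≥ 1/2 costs at most 2^n. -/
theorem lintegral_weightedTorusMeasure_smul_le {d n : ℕ} {ℓ : MvPolynomial (Fin d) ℂ}
    (hℓ : ℓ.IsHomogeneous n) {g : CSpace d → ℂ} (hg : Measurable g) {C : ℝ≥0∞} {r : ℝ}
    (hr : 1 / 2 ≤ r)
    (hC : ∫⁻ ζ, ‖MvPolynomial.eval ((r : ℂ) • ζ) ℓ * g ((r : ℂ) • ζ)‖ₑ ^ 2 ∂(torusMeasure d) ≤ C) :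
    ∫⁻ ζ, ‖g ((r : ℂ) • ζ)‖ₑ ^ 2 ∂(weightedTorusMeasure ℓ) ≤ (2 ^ n) ^ 2 * C := by
  have hmg : Measurable fun ζ : CSpace d => ‖g ((r : ℂ) • ζ)‖ₑ ^ 2 :=
    (hg.comp (continuous_const_smul (r : ℂ)).measurable).enorm.pow_const 2
  rw [weightedTorusMeasure,
    lintegral_withDensity_eq_lintegral_mul _ (enorm_eval_sq_measurable ℓ) hmg]
  refine le_trans ?_ (mul_le_mul_right hC _)
  rw [← lintegral_const_mul' _ _ (by finiteness)]
  refine lintegral_mono fun ζ => ?_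
  rw [Pi.mul_apply, ← mul_pow, ← mul_pow]
  refine pow_le_pow_left' ?_ 2
  rw [enorm_mul, ← mul_assoc]
  refine mul_le_mul_left ?_ _
  rw [eval_smul_of_isHomogeneous hℓ, enorm_mul, ← mul_assoc, enorm_pow, ← mul_pow]
  have h1 : (1 : ℝ≥0∞) ≤ 2 * ‖(r : ℂ)‖ₑ := by
    rw [← ofReal_norm, Complex.norm_real, Real.norm_of_nonneg (by linarith)]
    have h2 : (2 : ℝ≥0∞) = ENNReal.ofReal 2 := by simp
    rw [h2, ← ENNReal.ofReal_mul (by norm_num), ENNReal.one_le_ofReal]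
    linarith
  exact le_mul_of_one_le_left' (one_le_pow₀ h1)

/-! ### Impossibility of a bounded correction, and conclusion. -/

theorem not_memLp_top_quotientSymbol_add {d : ℕ} {G : Subgroup (CSpace d ≃ₗ[ℂ] CSpace d)}
    [Fintype G] {θ : Fin d → MvPolynomial (Fin d) ℂ} (hG : ActsOnPolydisc G)
    (hθ : IsBasicPolynomialMap G θ) {i j : Fin d} (hij : i ≠ j) {n : ℕ}
    {ℓ : MvPolynomial (Fin d) ℂ} (hℓ0 : ℓ ≠ 0) (hℓ : ℓ.IsHomogeneous n) {g gb : CSpace d → ℂ}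
    (hg : MemHardyQuotient θ ℓ g) (hgb : HasBoundaryFunction θ ℓ g gb) :
    ¬ MemLp (fun p => quotientSymbol G θ i j p + gb p) ⊤ (quotientMeasure G θ ℓ) := by
  classical
  intro hmem
  set m := weightedTorusMeasure ℓ
  obtain ⟨M, hM⟩ : ∃ M : ℝ, ∀ᵐ ζ ∂m, ‖averagedLog G i j ζ + gb (polyMap θ ζ)‖ ≤ M := by
    have h1 := hmem.2
    rw [eLpNorm_exponent_top] at h1
    refine ⟨(eLpNormEssSup (fun p => quotientSymbol G θ i j p + gb p)
      (quotientMeasure G θ ℓ)).toReal, ?_⟩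
    filter_upwards [ae_comp_polyMap (G := G) (ae_le_eLpNormEssSup
      (f := fun p => quotientSymbol G θ i j p + gb p)), ae_mem_torus_weighted ℓ]
      with ζ h2 hζ
    rw [quotientSymbol_polyMap hG hθ i j hζ] at h2
    rw [← toReal_enorm]
    exact ENNReal.toReal_mono h1.ne h2
  have hpoly : (0 : CSpace d) ∈ polydisc d := by simp [polydisc]
  have hopen : IsOpen (polydisc d) := by
    rw [polydisc_eq_ball]
    exact Metric.isOpen_ball
  have hd : DifferentiableOn ℂ (fun z => g (polyMap θ z)) (polydisc d) :=
    hg.1.comp (differentiable_polyMap θ).differentiableOn (Set.mapsTo_image _ _)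
  -- Nothing is known about g outside the image of the polydisc; extending g ∘ θ by 0 makes it
  -- measurable everywhere.
  set u : CSpace d → ℂ := (polydisc d).piecewise (fun z => g (polyMap θ z)) 0 with hu
  have hueq : ∀ z ∈ polydisc d, u z = g (polyMap θ z) := fun z hz =>
    Set.piecewise_eq_of_mem _ _ _ hz
  have hum : Measurable u :=
    hd.continuousOn.measurable_piecewise continuousOn_const hopen.measurableSet
  have hud : DifferentiableOn ℂ u (polydisc d) := hd.congr hueq
  -- Chosen so that M - K = Re u(0) - 1, an upper bound for the real part of the boundary function
  -- on E that contradicts its mean value u(0).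
  set K : ℝ := M - (u 0).re + 1
  set ε : ℝ := Real.exp (-(Fintype.card G * (K + Real.log 2)))
  set E := nearDiagonal (d := d) i j ε
  have hE : MeasurableSet E := (isOpen_nearDiagonal i j ε).measurableSet
  have hpos : 0 < m.real E := ENNReal.toReal_pos
    (weightedTorusMeasure_nearDiagonal_ne_zero hij (Real.exp_pos _) hℓ0) (measure_ne_top _ _)
  -- The shift by 2 keeps every radius in [1/2, 1), as the comparison of ℓ(rζ) with ℓ(ζ) requires.
  set r : ℕ → ℝ := fun k => 1 - 1 / (k + 2) with hr
  have hr2 : ∀ k, 1 / 2 ≤ r k := fun k => by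
    have : (1 : ℝ) / (k + 2) ≤ 1 / 2 := by
      gcongr
      linarith [(Nat.cast_nonneg k : (0 : ℝ) ≤ k)]
    simp only [hr]
    linarith
  have hr1 : ∀ k, r k < 1 := fun k => by
    have : (0 : ℝ) < 1 / (k + 2) := by positivity
    simp only [hr]
    linarith
  have hrlim : Tendsto r atTop (𝓝[<] 1) := by
    refine tendsto_nhdsWithin_iff.2 ⟨?_, Eventually.of_forall hr1⟩
    have h1 : Tendsto (fun k : ℕ => (1 : ℝ) / (k + 2)) atTop (𝓝 0) := by
      have := (tendsto_add_atTop_iff_nat 1).2 (tendsto_one_div_add_atTop_nhds_zero_nat (𝕜 := ℝ))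
      refine this.congr fun k => ?_
      push_cast
      ring_nf
    simpa [hr] using h1.const_sub 1
  have hin : ∀ k, ∀ ζ ∈ torus d, ((r k : ℝ) : ℂ) • ζ ∈ polydisc d := fun k ζ hζ =>
    smul_mem_polydisc (by
      rw [Complex.norm_real, Real.norm_of_nonneg (by linarith [hr2 k])]
      exact hr1 k) (torus_subset_closedBall d hζ)
  obtain ⟨C, hC, hbound⟩ := hg.2.2
  have hL2 : ∀ k, ∫⁻ ζ in E, ‖u ((r k : ℂ) • ζ)‖ₑ ^ 2 ∂m ≤ (2 ^ n) ^ 2 * C := by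
    intro k
    refine (setLIntegral_le_lintegral _ _).trans
      (lintegral_weightedTorusMeasure_smul_le hℓ hum (hr2 k) ?_)
    refine le_of_eq_of_le (lintegral_congr_ae ?_) (hbound (r k) (by linarith [hr2 k]) (hr1 k))
    filter_upwards [ae_mem_torus d] with ζ hζ
    rw [hueq _ (hin k ζ hζ)]
  have hlim : ∀ᵐ ζ ∂(m.restrict E), Tendsto (fun k => u ((r k : ℂ) • ζ)) atTop
      (𝓝 (gb (polyMap θ ζ))) := by
    refine ae_restrict_of_ae ?_
    filter_upwards [hgb, ae_mem_torus_weighted ℓ] with ζ h1 hζ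
    refine (h1.comp hrlim).congr fun k => ?_
    rw [Function.comp_apply, hueq _ (hin k ζ hζ)]
  obtain ⟨hgint, hconv⟩ := tendsto_integral_of_lintegral_sq_le
    (fun k => (hum.comp (continuous_const_smul ((r k : ℝ) : ℂ)).measurable).aestronglyMeasurable)
    (ENNReal.mul_lt_top (by finiteness) hC) hL2 hlim
  have hval : ∫ ζ in E, gb (polyMap θ ζ) ∂m = m.real E * u 0 := by
    refine tendsto_nhds_unique hconv (tendsto_const_nhds.congr fun k => ?_)
    exact (setIntegral_nearDiagonal i j ε hℓ hum hud (by linarith [hr2 k]) (hr1 k)).symm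
  have hre : ∫ ζ in E, (gb (polyMap θ ζ)).re ∂m = m.real E * (u 0).re := by
    have h1 := Complex.reCLM.integral_comp_comm hgint
    simp only [Complex.reCLM_apply] at h1
    rw [h1, hval, Complex.re_ofReal_mul]
  have hle : ∫ ζ in E, (gb (polyMap θ ζ)).re ∂m ≤ ∫ _ in E, (M - K) ∂m := by
    refine integral_mono_ae hgint.re (integrable_const _) ?_
    filter_upwards [ae_restrict_of_ae hM, ae_restrict_of_ae (ae_mem_torus_weighted ℓ),
      ae_restrict_mem hE] with ζ h1 hζ hζE
    have h2 := le_re_averagedLog hG i j K hζ hζE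
    have h3 := (Complex.re_le_norm _).trans h1
    rw [Complex.add_re] at h3
    linarith
  rw [hre, setIntegral_const, smul_eq_mul] at hle
  have := le_of_mul_le_mul_left hle hpos
  simp only [K] at this
  linarith

theorem mainTheorem5 (d : ℕ) (hd : 1 < d) (G : Subgroup (CSpace d ≃ₗ[ℂ] CSpace d)) [Fintype G]
    (hG : IsPseudoReflectionGroup G) (hGD : ActsOnPolydisc G)
    (θ : Fin d → MvPolynomial (Fin d) ℂ) (hθ : IsBasicPolynomialMap G θ) :
    shilovBoundary (polyMap θ '' polydisc d) = polyMap θ '' torus d ∧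
    ∃ Φ : CSpace d → ℂ,
      IsAveragedSymbol G θ ⟨0, lt_trans Nat.zero_lt_one hd⟩ ⟨1, hd⟩ Φ ∧
      ∀ (ρ : G →* ℂˣ) (ℓ : MvPolynomial (Fin d) ℂ), IsRelInvariantGenerator ρ ℓ →
        (∃ hΦ : MemLp Φ 2 (quotientMeasure G θ ℓ), IsBoundedBigHankel G θ ℓ hΦ) ∧
        ∀ g : CSpace d → ℂ, MemHardyQuotient θ ℓ g →
          ∀ gb : CSpace d → ℂ, HasBoundaryFunction θ ℓ g gb →
            ¬ MemLp (fun p => Φ p + gb p) ⊤ (quotientMeasure G θ ℓ) := by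
  have hij : (⟨0, lt_trans Nat.zero_lt_one hd⟩ : Fin d) ≠ ⟨1, hd⟩ := by simp
  refine ⟨shilovBoundary_polyMap_image hGD hθ, _, isAveragedSymbol_quotientSymbol hGD hθ hij,
    fun ρ ℓ hℓ => ⟨⟨_, isBoundedBigHankel_quotientSymbol hGD hθ hij hℓ⟩,
      fun g hg gb hgb => ?_⟩⟩
  obtain ⟨hℓ0, ⟨n, hn⟩, -⟩ := hℓ
  exact not_memLp_top_quotientSymbol_add hGD hθ hij hℓ0 hn hg hgb
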